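/- Let $(M,g)$ be a complete, simply connected smooth Riemannian manifold (of arbitrary finite dimension) without conjugate points, with Riemannian distance $d$ and unit tangent bundle $SM$. For $v\in SM$ let $\gamma_v:\mathbb R\to M$ be the geodesic with $\gamma_v'(0)=v$, let $b_v(x)=\lim_{t\to\infty}\bigl(d(x,\gamma_v(t))-t\bigr)$ be its Busemann function, and recall that $M$ is called asymptotically harmonic if there is a constant $h\ge 0$ such that, for every $v\in SM$, $b_v$ is of class $C^2$ and $\Delta b_v\equiv h$, where $\Delta=\operatorname{tr}\nabla d$; the horospheres (the level sets of the Busemann functions) are minimal if $h=0$. Suppose that $M$ is asymptotically harmonic with minimal horospheres, i.e. $\Delta b_v\equiv 0$ for all $v\in SM$, and that $M$ is a symmetric space, i.e. for every $p\in M$ there is an isometry $s_p$ of $M$ with $s_p(p)=p$ and $d(s_p)_p=-\mathrm{id}$. Then $M$ is flat, i.e. its Riemann curvature tensor vanishes identically. -/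

import Mathlib

open Filter Topology
open scoped Manifold ContDiff

set_option maxSynthPendingDepth 3

noncomputable section

namespace RiemGeom

/-! ### Levi-Civita calculus in coordinates

`G y` is the bilinear form of the metric at the point `y` of a coordinate domain in `E`. -/

section Coordinates

variable {E : Type*} [NormedAddCommGroup E] [NormedSpace ℝ E]

/-- `(u, w, z) ↦ ∂_z G(u, w)`. -/
def metricDerivRot (G : E → E →L[ℝ] E →L[ℝ] ℝ) (y : E) : E →L[ℝ] E →L[ℝ] E →L[ℝ] ℝ :=
  ((ContinuousLinearMap.flipₗᵢ ℝ E E ℝ).toContinuousLinearEquiv :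
      (E →L[ℝ] E →L[ℝ] ℝ) →L[ℝ] (E →L[ℝ] E →L[ℝ] ℝ)) ∘L (fderiv ℝ G y).flip

/-- Christoffel symbols of the first kind,
`(u, w, z) ↦ ½ (∂_u G(w, z) + ∂_w G(u, z) - ∂_z G(u, w))`. -/
def christoffelLower (G : E → E →L[ℝ] E →L[ℝ] ℝ) (y : E) : E →L[ℝ] E →L[ℝ] E →L[ℝ] ℝ :=
  (1 / 2 : ℝ) • (fderiv ℝ G y + (fderiv ℝ G y).flip - metricDerivRot G y)

theorem christoffelLower_apply (G : E → E →L[ℝ] E →L[ℝ] ℝ) (y u w z : E) :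
    christoffelLower G y u w z =
      (1 / 2 : ℝ) * (fderiv ℝ G y u w z + fderiv ℝ G y w u z - fderiv ℝ G y z u w) := rfl

/-- Christoffel symbols `Γ(u, w)` of the Levi-Civita connection, obtained from the symbols of the
first kind by raising an index with `G⁻¹`. -/
def christoffel (G : E → E →L[ℝ] E →L[ℝ] ℝ) (y : E) : E →L[ℝ] E →L[ℝ] E :=
  (ContinuousLinearMap.compL ℝ E (E →L[ℝ] ℝ) E (G y).inverse) ∘L christoffelLower G y

/-- The curvature tensor in coordinates,
`R(u, v)w = (∂_u Γ)(v, w) - (∂_v Γ)(u, w) + Γ(u, Γ(v, w)) - Γ(v, Γ(u, w))`, that is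
`R(X, Y)Z = ∇_X ∇_Y Z - ∇_Y ∇_X Z - ∇_[X, Y] Z`. -/
def coordCurvature (G : E → E →L[ℝ] E →L[ℝ] ℝ) (y u v w : E) : E :=
  fderiv ℝ (christoffel G) y u v w - fderiv ℝ (christoffel G) y v u w +
    christoffel G y u (christoffel G y v w) - christoffel G y v (christoffel G y u w)

/-- The Hessian `∇df` in coordinates, `(u, w) ↦ ∂_u ∂_w f - df(Γ(u, w))`. -/
def coordHessian (G : E → E →L[ℝ] E →L[ℝ] ℝ) (f : E → ℝ) (y : E) : E →L[ℝ] E →L[ℝ] ℝ :=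
  fderiv ℝ (fderiv ℝ f) y - (ContinuousLinearMap.compL ℝ E E ℝ (fderiv ℝ f y)) ∘L christoffel G y

/-- The Laplace-Beltrami operator in coordinates: the trace of the Hessian with respect to `G`. -/
def coordLaplacian (G : E → E →L[ℝ] E →L[ℝ] ℝ) (f : E → ℝ) (y : E) : ℝ :=
  LinearMap.trace ℝ E (((G y).inverse ∘L coordHessian G f y : E →L[ℝ] E) : E →ₗ[ℝ] E)

end Coordinates

/-! ### Riemannian manifolds

`M` is a smooth manifold without boundary modelled on the finite-dimensional space `E`.  The chart
with centre `c : M` is `extChartAt 𝓘(ℝ, E) c`.  The instance `RiemannianBundle` is the Riemannian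
metric. -/

open Bundle

section Charts

variable {E : Type*} [NormedAddCommGroup E] [NormedSpace ℝ E]
  {M : Type*} [TopologicalSpace M] [ChartedSpace E M]

/-- The coordinates of a tangent vector at `x` in the chart centred at `c`. -/
def coord (c x : M) : TangentSpace 𝓘(ℝ, E) x →L[ℝ] E :=
  mfderiv 𝓘(ℝ, E) 𝓘(ℝ, E) (extChartAt 𝓘(ℝ, E) c) x

/-- The velocity `γ'(t)` of a curve. -/
def velocity (E : Type*) [NormedAddCommGroup E] [NormedSpace ℝ E] {M : Type*} [TopologicalSpace M]
    [ChartedSpace E M] (γ : ℝ → M) (t : ℝ) : TangentSpace 𝓘(ℝ, E) (γ t) :=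
  mfderiv 𝓘(ℝ, ℝ) 𝓘(ℝ, E) γ t (1 : ℝ)

variable [RiemannianBundle (fun x : M ↦ TangentSpace 𝓘(ℝ, E) x)]

/-- The metric coefficients in the chart centred at `c`: the Riemannian metric pulled back by the
inverse of the chart. -/
def chartMetric (c : M) (y : E) : E →L[ℝ] E →L[ℝ] ℝ :=
  (innerSL ℝ (E := TangentSpace 𝓘(ℝ, E) ((extChartAt 𝓘(ℝ, E) c).symm y))).bilinearComp
    (mfderiv 𝓘(ℝ, E) 𝓘(ℝ, E) (extChartAt 𝓘(ℝ, E) c).symm y)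
    (mfderiv 𝓘(ℝ, E) 𝓘(ℝ, E) (extChartAt 𝓘(ℝ, E) c).symm y)

/-- The Riemann curvature tensor `R(u, v)w` at `p`. -/
def curvature (p : M) (u v w : TangentSpace 𝓘(ℝ, E) p) : TangentSpace 𝓘(ℝ, E) p :=
  (coord p p).inverse (coordCurvature (chartMetric p) (extChartAt 𝓘(ℝ, E) p p)
    (coord p p u) (coord p p v) (coord p p w))

/-- The Laplace-Beltrami operator `Δ = tr ∇d`. -/
def laplacian (E : Type*) [NormedAddCommGroup E] [NormedSpace ℝ E] {M : Type*} [TopologicalSpace M]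
    [ChartedSpace E M] [RiemannianBundle (fun x : M ↦ TangentSpace 𝓘(ℝ, E) x)]
    (f : M → ℝ) (p : M) : ℝ :=
  coordLaplacian (chartMetric p) (f ∘ (extChartAt 𝓘(ℝ, E) p).symm) (extChartAt 𝓘(ℝ, E) p p)

/-- The covariant derivative `V'(t)` of a vector field `V` along the curve `γ`; in coordinates
`dV/dt + Γ(γ', V)`. -/
def covDerivAlong (γ : ℝ → M) (V : ∀ t, TangentSpace 𝓘(ℝ, E) (γ t)) (t : ℝ) :
    TangentSpace 𝓘(ℝ, E) (γ t) :=
  (coord (γ t) (γ t)).inverse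
    (deriv (fun s ↦ coord (γ t) (γ s) (V s)) t +
      christoffel (chartMetric (γ t)) (extChartAt 𝓘(ℝ, E) (γ t) (γ t))
        (coord (γ t) (γ t) (velocity E γ t)) (coord (γ t) (γ t) (V t)))

end Charts

/-! ### Geodesics, Jacobi fields, Busemann functions -/

section Manifold

variable (E : Type*) [NormedAddCommGroup E] [NormedSpace ℝ E]
  {M : Type*} [MetricSpace M] [ChartedSpace E M] [IsManifold 𝓘(ℝ, E) ∞ M]
  [RiemannianBundle (fun x : M ↦ TangentSpace 𝓘(ℝ, E) x)]

/-- Geodesics defined on the whole real line. -/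
structure IsGeodesic (γ : ℝ → M) : Prop where
  contMDiff : ContMDiff 𝓘(ℝ, ℝ) 𝓘(ℝ, E) ∞ γ
  covDeriv_velocity : ∀ t, covDerivAlong γ (velocity E γ) t = 0

/-- Geodesics `γ_v` with `v` in the unit tangent bundle. -/
structure IsUnitSpeedGeodesic (γ : ℝ → M) : Prop extends IsGeodesic E γ where
  norm_velocity : ∀ t, ‖velocity E γ t‖ = 1

variable {E} in
/-- Jacobi fields along `γ`: smooth vector fields along `γ` with `J'' + R(J, γ')γ' = 0`. -/
structure IsJacobiField (γ : ℝ → M) (J : ∀ t, TangentSpace 𝓘(ℝ, E) (γ t)) : Prop where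
  contMDiff : ContMDiff 𝓘(ℝ, ℝ) 𝓘(ℝ, E).tangent ∞
    (fun t ↦ (⟨γ t, J t⟩ : TangentBundle 𝓘(ℝ, E) M))
  jacobi : ∀ t, covDerivAlong γ (covDerivAlong γ J) t +
    curvature (γ t) (J t) (velocity E γ t) (velocity E γ t) = 0

variable (M) in
/-- No conjugate points: a Jacobi field along a geodesic that vanishes at two different parameters
vanishes identically. -/
def NoConjugatePoints : Prop :=
  ∀ (γ : ℝ → M) (J : ∀ t, TangentSpace 𝓘(ℝ, E) (γ t)), IsGeodesic E γ → IsJacobiField γ J →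
    ∀ a b : ℝ, a ≠ b → J a = 0 → J b = 0 → ∀ t, J t = 0

/-- `b` is the Busemann function of `γ`: `b(x) = lim_{t → ∞} (d(x, γ(t)) - t)` for all `x`. -/
def IsBusemannFunction {M : Type*} [MetricSpace M] (γ : ℝ → M) (b : M → ℝ) : Prop :=
  ∀ x, Tendsto (fun t : ℝ ↦ dist x (γ t) - t) atTop (𝓝 (b x))

variable (M) in
/-- `M` is asymptotically harmonic and its horospheres have mean curvature `h`: `M` is complete,
simply connected, without conjugate points, and every Busemann function `b_v` satisfies
`Δ b_v ≡ h`. The horospheres are minimal if `h = 0`. -/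
structure IsAsymptoticallyHarmonic (h : ℝ) : Prop where
  complete : CompleteSpace M
  simplyConnected : SimplyConnectedSpace M
  noConjugatePoints : NoConjugatePoints E M
  nonneg : 0 ≤ h
  laplacian_busemann : ∀ γ : ℝ → M, IsUnitSpeedGeodesic E γ →
    ∃ b : M → ℝ, IsBusemannFunction γ b ∧ ContMDiff 𝓘(ℝ, E) 𝓘(ℝ, ℝ) 2 b ∧
      ∀ x, laplacian E b x = h

variable (M) in
/-- Riemannian symmetric spaces: every point `p` is fixed by an isometry of `M` whose differential
at `p` is `-id`. -/
def IsSymmetricSpace : Prop :=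
  ∀ p : M, ∃ s : M ≃ₘ^∞⟮𝓘(ℝ, E), 𝓘(ℝ, E)⟯ M,
    (∀ (x : M) (u w : TangentSpace 𝓘(ℝ, E) x),
      inner ℝ (mfderiv 𝓘(ℝ, E) 𝓘(ℝ, E) s x u) (mfderiv 𝓘(ℝ, E) 𝓘(ℝ, E) s x w) = inner ℝ u w) ∧
    ∀ u : TangentSpace 𝓘(ℝ, E) p,
      tangentMap 𝓘(ℝ, E) 𝓘(ℝ, E) s ⟨p, u⟩ = (⟨p, -u⟩ : TangentBundle 𝓘(ℝ, E) M)

variable (M) in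
/-- `M` is flat: its curvature tensor vanishes identically. -/
def IsFlat : Prop :=
  ∀ (p : M) (u v w : TangentSpace 𝓘(ℝ, E) p), curvature p u v w = 0

end Manifold

end RiemGeom

end

open Bundle

/-!
A unit speed geodesic `γ` of a symmetric space is translated by transvections, products of two
geodesic symmetries, so it is complete; as it has a Busemann function `b`, it is a line. The
symmetry `s` at a point of `γ` reverses `γ`. If `b'` is the Busemann function of the reversed ray,
then `b' ∘ s = b` up to a constant, so `b` and `b'` have the same Hessian at that point, and the
triangle inequality says that `b + b'` is minimal there. Hence `∇db ≥ 0` along `γ`, and as the trace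
of `∇db` is `Δb ≤ 0`, `∇db` vanishes along `γ`. The field `X = -∇b` has unit length, so `∇_X X = 0`,
and it extends `γ'`; since `∇X = 0` along `γ`, the Riccati equation reduces to `R(w, γ')γ' = 0`.
Polarisation and the Bianchi identity give `R = 0`.
-/

namespace RiemGeom

/-! ### Riemannian metrics in coordinates -/

section Coordinates

variable {E : Type*} [NormedAddCommGroup E] [NormedSpace ℝ E]

theorem hasFDerivAt_fderiv {F' : Type*} [NormedAddCommGroup F'] [NormedSpace ℝ F'] {f : E → F'}
    {x : E} (hf : ContDiffAt ℝ 2 f x) : HasFDerivAt (fderiv ℝ f) (fderiv ℝ (fderiv ℝ f) x) x :=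
  ((hf.fderiv_right (m := 1) (by norm_num)).differentiableAt (by simp)).hasFDerivAt

theorem hasDerivAt_deriv {y : ℝ → E} {t : ℝ} (hy : ContDiffAt ℝ 2 y t) :
    HasDerivAt (deriv y) (deriv (deriv y) t) t :=
  ((hasFDerivAt_fderiv hy).clm_apply (hasFDerivAt_const (1 : ℝ) t)).differentiableAt.hasDerivAt

/-- `G` is a smooth Riemannian metric on the open set `U` of the coordinate space. -/
structure IsMetricOn (G : E → E →L[ℝ] E →L[ℝ] ℝ) (U : Set E) : Prop where
  isOpen : IsOpen U
  contDiffOn : ContDiffOn ℝ ∞ G U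
  symm : ∀ y ∈ U, ∀ u w, G y u w = G y w u
  pos : ∀ y ∈ U, ∀ u, u ≠ 0 → 0 < G y u u

theorem fderiv_bilin_apply {G : E → E →L[ℝ] E →L[ℝ] ℝ} {y : E} (hG : DifferentiableAt ℝ G y)
    (u w z : E) : fderiv ℝ (fun x ↦ G x u w) y z = fderiv ℝ G y z u w := by
  rw [((hG.hasFDerivAt.clm_apply (hasFDerivAt_const u y)).clm_apply
    (hasFDerivAt_const w y)).fderiv]
  simp

namespace IsMetricOn

variable {G : E → E →L[ℝ] E →L[ℝ] ℝ} {U : Set E} {y : E}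

theorem contDiffAt (h : IsMetricOn G U) (hy : y ∈ U) : ContDiffAt ℝ ∞ G y :=
  h.contDiffOn.contDiffAt (h.isOpen.mem_nhds hy)

theorem differentiableAt (h : IsMetricOn G U) (hy : y ∈ U) : DifferentiableAt ℝ G y :=
  (h.contDiffAt hy).differentiableAt (by simp)

theorem eventually_mem (h : IsMetricOn G U) (hy : y ∈ U) : ∀ᶠ x in 𝓝 y, x ∈ U :=
  h.isOpen.mem_nhds hy

theorem fderiv_symm (h : IsMetricOn G U) (hy : y ∈ U) (z u w : E) :
    fderiv ℝ G y z u w = fderiv ℝ G y z w u := by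
  rw [← fderiv_bilin_apply (h.differentiableAt hy), ← fderiv_bilin_apply (h.differentiableAt hy)]
  have heq : (fun x ↦ G x u w) =ᶠ[𝓝 y] fun x ↦ G x w u :=
    (h.eventually_mem hy).mono fun x hx ↦ h.symm x hx u w
  rw [heq.fderiv_eq]

theorem eq_of_forall (h : IsMetricOn G U) (hy : y ∈ U) {a b : E}
    (hab : ∀ z, G y a z = G y b z) : a = b := by
  by_contra hne
  have hpos := h.pos y hy (a - b) (sub_ne_zero.2 hne)
  simp [hab] at hpos

variable [FiniteDimensional ℝ E]

theorem isInvertible (h : IsMetricOn G U) (hy : y ∈ U) : (G y).IsInvertible := by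
  have hinj : Function.Injective (G y : E →ₗ[ℝ] (E →L[ℝ] ℝ)) := fun a b hab ↦
    h.eq_of_forall hy fun z ↦ congrArg (fun φ : E →L[ℝ] ℝ ↦ φ z) hab
  have hdim : Module.finrank ℝ E = Module.finrank ℝ (E →L[ℝ] ℝ) := by
    rw [← (LinearMap.toContinuousLinearMap (𝕜 := ℝ) (E := E) (F' := ℝ)).finrank_eq]
    exact Subspace.dual_finrank_eq.symm
  refine ⟨(LinearEquiv.ofInjectiveOfFinrankEq _ hinj hdim).toContinuousLinearEquiv, ?_⟩
  ext u w
  rfl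

theorem apply_inverse (h : IsMetricOn G U) (hy : y ∈ U) (φ : E →L[ℝ] ℝ) (z : E) :
    G y ((G y).inverse φ) z = φ z := by
  rw [(h.isInvertible hy).self_apply_inverse]

theorem contDiffOn_inverse (h : IsMetricOn G U) :
    ContDiffOn ℝ ∞ (fun x ↦ (G x).inverse) U := by
  have := FiniteDimensional.complete ℝ E
  intro x hx
  obtain ⟨e, he⟩ := h.isInvertible hx
  have hinv : ContDiffAt ℝ ∞ ContinuousLinearMap.inverse (G x) := he ▸ contDiffAt_map_inverse e
  exact (hinv.comp x (h.contDiffAt hx)).contDiffWithinAt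

theorem apply_christoffel (h : IsMetricOn G U) (hy : y ∈ U) (u w z : E) :
    G y (christoffel G y u w) z =
      (1 / 2 : ℝ) * (fderiv ℝ G y u w z + fderiv ℝ G y w u z - fderiv ℝ G y z u w) := by
  rw [← christoffelLower_apply]
  exact h.apply_inverse hy _ _

theorem christoffel_symm (h : IsMetricOn G U) (hy : y ∈ U) (u w : E) :
    christoffel G y u w = christoffel G y w u := by
  refine h.eq_of_forall hy fun z ↦ ?_
  rw [h.apply_christoffel hy, h.apply_christoffel hy, h.fderiv_symm hy z u w]
  ring

theorem contDiffOn_christoffel (h : IsMetricOn G U) : ContDiffOn ℝ ∞ (christoffel G) U := by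
  have hd : ContDiffOn ℝ ∞ (fderiv ℝ G) U := h.contDiffOn.fderiv_of_isOpen h.isOpen (by simp)
  have hf : ContDiffOn ℝ ∞ (fun x ↦ (fderiv ℝ G x).flip) U :=
    (ContinuousLinearMap.flipₗᵢ ℝ E E (E →L[ℝ] ℝ)).contDiff.comp_contDiffOn hd
  have hr : ContDiffOn ℝ ∞ (metricDerivRot G) U := contDiffOn_const.clm_comp hf
  have hl : ContDiffOn ℝ ∞ (christoffelLower G) U := ((hd.add hf).sub hr).const_smul (1 / 2 : ℝ)
  exact ((ContinuousLinearMap.compL ℝ E (E →L[ℝ] ℝ) E).contDiff.comp_contDiffOn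
    h.contDiffOn_inverse).clm_comp hl

theorem contDiffAt_christoffel (h : IsMetricOn G U) (hy : y ∈ U) :
    ContDiffAt ℝ ∞ (christoffel G) y :=
  h.contDiffOn_christoffel.contDiffAt (h.isOpen.mem_nhds hy)

end IsMetricOn

theorem coordHessian_congr {G : E → E →L[ℝ] E →L[ℝ] ℝ} {f f' : E → ℝ} {y : E}
    (h : f =ᶠ[𝓝 y] f') : coordHessian G f y = coordHessian G f' y := by
  rw [coordHessian, coordHessian, h.fderiv.fderiv_eq, h.fderiv_eq]

/-- The covariant acceleration `y'' + Γ(y', y')` of a curve in coordinates. -/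
noncomputable def coordAccel (G : E → E →L[ℝ] E →L[ℝ] ℝ) (y : ℝ → E) (t : ℝ) : E :=
  deriv (deriv y) t + christoffel G (y t) (deriv y t) (deriv y t)

/-- `F` is of class `C²` at `y` and, near `y`, pulls the metric `G₂` back to the metric `G`. -/
structure IsLocalIsometryAt (G G₂ : E → E →L[ℝ] E →L[ℝ] ℝ) (F : E → E) (y : E) : Prop where
  contDiffAt : ContDiffAt ℝ 2 F y
  eventually_pullback_eq :
    ∀ᶠ x in 𝓝 y, ∀ u w, G₂ (F x) (fderiv ℝ F x u) (fderiv ℝ F x w) = G x u w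

namespace IsLocalIsometryAt

variable {G G₂ : E → E →L[ℝ] E →L[ℝ] ℝ} {U U₂ : Set E} {F : E → E} {y : E}

theorem hasFDerivAt (hF : IsLocalIsometryAt G G₂ F y) : HasFDerivAt F (fderiv ℝ F y) y :=
  (hF.contDiffAt.differentiableAt (by simp)).hasFDerivAt

theorem surjective_fderiv [FiniteDimensional ℝ E] (hF : IsLocalIsometryAt G G₂ F y)
    (h : IsMetricOn G U) (hy : y ∈ U) : Function.Surjective (fderiv ℝ F y) := by
  refine (fderiv ℝ F y : E →ₗ[ℝ] E).injective_iff_surjective.1 ?_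
  refine (injective_iff_map_eq_zero _).2 fun u (hu : fderiv ℝ F y u = 0) ↦ ?_
  by_contra hne
  have hpos := h.pos y hy u hne
  rw [← hF.eventually_pullback_eq.self_of_nhds, hu, map_zero] at hpos
  exact lt_irrefl _ hpos

theorem fderiv_metric (hF : IsLocalIsometryAt G G₂ F y) (h : IsMetricOn G U) (hy : y ∈ U)
    (h₂ : IsMetricOn G₂ U₂) (hFy : F y ∈ U₂) (z u w : E) :
    fderiv ℝ G y z u w =
      fderiv ℝ G₂ (F y) (fderiv ℝ F y z) (fderiv ℝ F y u) (fderiv ℝ F y w) +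
        G₂ (F y) (fderiv ℝ (fderiv ℝ F) y z u) (fderiv ℝ F y w) +
        G₂ (F y) (fderiv ℝ F y u) (fderiv ℝ (fderiv ℝ F) y z w) := by
  have hF₂ := hasFDerivAt_fderiv hF.contDiffAt
  have hG₂ : HasFDerivAt (fun x ↦ G₂ (F x)) ((fderiv ℝ G₂ (F y)).comp (fderiv ℝ F y)) y :=
    (h₂.differentiableAt hFy).hasFDerivAt.comp y hF.hasFDerivAt
  have hpull : (fun x ↦ G x u w) =ᶠ[𝓝 y]
      fun x ↦ G₂ (F x) (fderiv ℝ F x u) (fderiv ℝ F x w) :=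
    hF.eventually_pullback_eq.mono fun x hx ↦ (hx u w).symm
  have hderiv := (hG₂.clm_apply (hF₂.clm_apply (hasFDerivAt_const u y))).clm_apply
    (hF₂.clm_apply (hasFDerivAt_const w y))
  rw [← fderiv_bilin_apply (h.differentiableAt hy), hpull.fderiv_eq, hderiv.fderiv]
  simp only [ContinuousLinearMap.comp_zero, zero_add, ContinuousLinearMap.flip_add, add_apply,
    ContinuousLinearMap.comp_apply, ContinuousLinearMap.flip_apply]
  ring

variable [FiniteDimensional ℝ E]

theorem map_christoffel (hF : IsLocalIsometryAt G G₂ F y) (h : IsMetricOn G U) (hy : y ∈ U)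
    (h₂ : IsMetricOn G₂ U₂) (hFy : F y ∈ U₂) (u w : E) :
    fderiv ℝ F y (christoffel G y u w) = fderiv ℝ (fderiv ℝ F) y u w +
      christoffel G₂ (F y) (fderiv ℝ F y u) (fderiv ℝ F y w) := by
  have hsym : ∀ u w, fderiv ℝ (fderiv ℝ F) y u w = fderiv ℝ (fderiv ℝ F) y w u :=
    fun u w ↦ hF.contDiffAt.isSymmSndFDerivAt (by simp) u w
  refine h₂.eq_of_forall hFy fun z' ↦ ?_
  obtain ⟨z, rfl⟩ := hF.surjective_fderiv h hy z'
  rw [hF.eventually_pullback_eq.self_of_nhds, h.apply_christoffel hy, map_add, add_apply,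
    h₂.apply_christoffel hFy, hF.fderiv_metric h hy h₂ hFy, hF.fderiv_metric h hy h₂ hFy,
    hF.fderiv_metric h hy h₂ hFy, hsym w u, hsym z w, hsym z u,
    h₂.symm _ hFy (fderiv ℝ F y w), h₂.symm _ hFy (fderiv ℝ (fderiv ℝ F) y u z)]
  ring

theorem coordHessian_comp (hF : IsLocalIsometryAt G G₂ F y) (h : IsMetricOn G U) (hy : y ∈ U)
    (h₂ : IsMetricOn G₂ U₂) (hFy : F y ∈ U₂) {f : E → ℝ} (hf : ContDiffAt ℝ 2 f (F y))
    (u w : E) :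
    coordHessian G (f ∘ F) y u w =
      coordHessian G₂ f (F y) (fderiv ℝ F y u) (fderiv ℝ F y w) := by
  have hcomp : fderiv ℝ (f ∘ F) =ᶠ[𝓝 y] fun x ↦ (fderiv ℝ f (F x)).comp (fderiv ℝ F x) := by
    filter_upwards [hF.contDiffAt.eventually (by simp),
      hF.contDiffAt.continuousAt.eventually (hf.eventually (by simp))] with x hFx hfx
    exact fderiv_comp x (hfx.differentiableAt (by simp)) (hFx.differentiableAt (by simp))
  have hchain : HasFDerivAt (fun x ↦ fderiv ℝ f (F x)) _ y :=
    (hasFDerivAt_fderiv hf).comp y hF.hasFDerivAt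
  have hsnd : fderiv ℝ (fderiv ℝ (f ∘ F)) y u w =
      fderiv ℝ (fderiv ℝ f) (F y) (fderiv ℝ F y u) (fderiv ℝ F y w) +
        fderiv ℝ f (F y) (fderiv ℝ (fderiv ℝ F) y u w) := by
    rw [hcomp.fderiv_eq, (hchain.clm_comp (hasFDerivAt_fderiv hF.contDiffAt)).fderiv]
    simp [add_comm]
  simp only [coordHessian, sub_apply, ContinuousLinearMap.comp_apply,
    ContinuousLinearMap.compL_apply, hsnd, hcomp.self_of_nhds,
    hF.map_christoffel h hy h₂ hFy u w, map_add]
  ring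

theorem coordAccel_comp {y : ℝ → E} {t : ℝ} (hF : IsLocalIsometryAt G G₂ F (y t))
    (h : IsMetricOn G U) (hy : y t ∈ U) (h₂ : IsMetricOn G₂ U₂) (hFy : F (y t) ∈ U₂)
    (hyt : ContDiffAt ℝ 2 y t) :
    coordAccel G₂ (F ∘ y) t = fderiv ℝ F (y t) (coordAccel G y t) := by
  have hcomp : deriv (F ∘ y) =ᶠ[𝓝 t] fun s ↦ fderiv ℝ F (y s) (deriv y s) := by
    filter_upwards [hyt.eventually (by simp),
      hyt.continuousAt.eventually (hF.contDiffAt.eventually (by simp))] with s hys hFs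
    exact fderiv_comp_deriv s (hFs.differentiableAt (by simp)) (hys.differentiableAt (by simp))
  have hchain : HasDerivAt (fun s ↦ fderiv ℝ F (y s)) _ t :=
    (hasFDerivAt_fderiv hF.contDiffAt).comp_hasDerivAt t
      (hyt.differentiableAt (by simp)).hasDerivAt
  rw [coordAccel, coordAccel, hcomp.deriv_eq, hcomp.self_of_nhds, map_add,
    hF.map_christoffel h hy h₂ hFy, (hchain.clm_apply (hasDerivAt_deriv hyt)).deriv]
  simp only [Function.comp_apply]
  abel

end IsLocalIsometryAt

end Coordinates

/-! ### Curvature of parallel fields of class `C¹` -/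

section LocalAnalysis

open Asymptotics

variable {E : Type*} [NormedAddCommGroup E] [NormedSpace ℝ E]

theorem norm_image_sub_sub_smul_le {f f' : ℝ → E} {c : E} {C a b : ℝ} (hab : a ≤ b)
    (hf : ∀ x ∈ Set.Icc a b, HasDerivAt f (f' x) x)
    (bound : ∀ x ∈ Set.Ico a b, ‖f' x - c‖ ≤ C) :
    ‖f b - f a - (b - a) • c‖ ≤ C * (b - a) := by
  have hderiv : ∀ x ∈ Set.Icc a b,
      HasDerivWithinAt (fun x ↦ f x - x • c) (f' x - c) (Set.Icc a b) x := fun x hx ↦ by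
    simpa using ((hf x hx).fun_sub ((hasDerivAt_id' x).smul_const c)).hasDerivWithinAt
  convert norm_image_sub_le_of_norm_deriv_le_segment' hderiv bound b ⟨hab, le_rfl⟩ using 2
  module

theorem norm_inv_smul_image_sub_sub_smul_le {f f' : ℝ → E} {c : E} {C t ε : ℝ} (ht : 0 ≤ t)
    (hε : 0 < ε) (hf : ∀ x ∈ Set.Icc 0 t, HasDerivAt f (f' x) x)
    (bound : ∀ x ∈ Set.Ico 0 t, ‖f' x - ε • c‖ ≤ C * ε) :
    ‖ε⁻¹ • (f t - f 0) - t • c‖ ≤ C * t := by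
  have hscale : ε⁻¹ • (f t - f 0) - t • c = ε⁻¹ • (f t - f 0 - (t - 0) • ε • c) := by
    rw [sub_zero, smul_comm t, smul_sub _ _ (ε • t • c), inv_smul_smul₀ hε.ne']
  rw [hscale, norm_smul, norm_inv, Real.norm_of_nonneg hε.le, inv_mul_le_iff₀ hε]
  linarith [norm_image_sub_sub_smul_le ht hf bound]

-- Interchange of partial derivatives for `f (t, ε)` without second derivatives: `g = ∂f/∂t` and
-- `k = ∂f/∂ε`, the latter only on the axis `ε = 0`.
theorem hasDerivWithinAt_of_mixed_isLittleO {f g : ℝ × ℝ → E} {k : ℝ → E} {c : E}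
    (hf : ∀ᶠ p in 𝓝 (0 : ℝ × ℝ), HasDerivAt (fun t ↦ f (t, p.2)) (g p) p.1)
    (hk : ∀ᶠ t in 𝓝 (0 : ℝ), HasDerivAt (fun ε ↦ f (t, ε)) (k t) 0)
    (hg : (fun p : ℝ × ℝ ↦ g p - g (p.1, 0) - p.2 • c) =o[𝓝 0] fun p ↦ p.2) :
    HasDerivWithinAt k c (Set.Ici 0) 0 := by
  rw [hasDerivWithinAt_iff_isLittleO, isLittleO_iff]
  intro η hη
  obtain ⟨δ, hδ, hball⟩ := Metric.eventually_nhds_iff.1 (hf.and (isLittleO_iff.1 hg hη))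
  obtain ⟨δ', hδ', hk'⟩ := Metric.eventually_nhds_iff.1 hk
  filter_upwards [nhdsWithin_le_nhds (Iio_mem_nhds (lt_min hδ hδ')), self_mem_nhdsWithin]
    with t (ht : t < min δ δ') (ht0 : 0 ≤ t)
  have hmem : ∀ s ∈ Set.Icc 0 t, ∀ ε, |ε| < δ → dist ((s, ε) : ℝ × ℝ) 0 < δ := fun s hs ε hε ↦ by
    rw [Prod.dist_eq, max_lt_iff]
    exact ⟨by simpa [abs_of_nonneg hs.1] using hs.2.trans_lt (ht.trans_le (min_le_left _ _)),
      by simpa using hε⟩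
  have hquot : ∀ ε ∈ Set.Ioo 0 δ,
      ‖ε⁻¹ • (f (t, ε) - f (t, 0)) - ε⁻¹ • (f (0, ε) - f (0, 0)) - t • c‖ ≤ η * t := by
    rintro ε ⟨hε, hεδ⟩
    have hεmem : ∀ s ∈ Set.Icc 0 t, dist ((s, ε) : ℝ × ℝ) 0 < δ :=
      fun s hs ↦ hmem s hs ε (by rwa [abs_of_pos hε])
    rw [← smul_sub]
    exact norm_inv_smul_image_sub_sub_smul_le (f := fun s ↦ f (s, ε) - f (s, 0)) ht0 hε
      (fun s hs ↦ (hball (hεmem s hs)).1.sub (hball (hmem s hs 0 (by simpa using hδ))).1)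
      (fun s hs ↦ by
        simpa [abs_of_pos hε] using (hball (hεmem s (Set.Ico_subset_Icc_self hs))).2)
  have hlim : ∀ s ∈ Set.Icc 0 t,
      Tendsto (fun ε : ℝ ↦ ε⁻¹ • (f (s, ε) - f (s, 0))) (𝓝[>] 0) (𝓝 (k s)) := fun s hs ↦ by
    have hsk : HasDerivAt (fun ε ↦ f (s, ε)) (k s) 0 := hk' <| by
      simpa [abs_of_nonneg hs.1] using hs.2.trans_lt (ht.trans_le (min_le_right _ _))
    simpa using hsk.tendsto_slope_zero_right
  have hle : ‖k t - k 0 - t • c‖ ≤ η * t :=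
    le_of_tendsto (((hlim t ⟨ht0, le_rfl⟩).sub (hlim 0 ⟨le_rfl, ht0⟩)).sub_const _).norm
      (eventually_of_mem (Ioo_mem_nhdsGT hδ) hquot)
  simpa [abs_of_nonneg ht0] using hle

theorem tendsto_variation {γ P : ℝ → E} (hγ : ContinuousAt γ 0) (hP : ContinuousAt P 0) :
    Tendsto (fun p : ℝ × ℝ ↦ γ p.1 + p.2 • P p.1) (𝓝 0) (𝓝 (γ 0)) := by
  have hfst : Tendsto Prod.fst (𝓝 (0 : ℝ × ℝ)) (𝓝 0) := continuousAt_fst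
  have hsnd : Tendsto Prod.snd (𝓝 (0 : ℝ × ℝ)) (𝓝 0) := continuousAt_snd
  simpa using (hγ.tendsto.comp hfst).add (hsnd.smul (hP.tendsto.comp hfst))

theorem isLittleO_variation {F : Type*} [NormedAddCommGroup F] [NormedSpace ℝ F] {A : E → F}
    {A' : E →L[ℝ] F} {γ P : ℝ → E} (hA : HasStrictFDerivAt A A' (γ 0)) (hγ : ContinuousAt γ 0)
    (hP : ContinuousAt P 0) :
    (fun p : ℝ × ℝ ↦ A (γ p.1 + p.2 • P p.1) - A (γ p.1) - p.2 • A' (P 0))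
      =o[𝓝 0] fun p ↦ p.2 := by
  have hfst : Tendsto Prod.fst (𝓝 (0 : ℝ × ℝ)) (𝓝 0) := continuousAt_fst
  have hPfst : Tendsto (fun p : ℝ × ℝ ↦ P p.1) (𝓝 0) (𝓝 (P 0)) := hP.tendsto.comp hfst
  have hdiff : (fun p : ℝ × ℝ ↦ p.2 • P p.1) =O[𝓝 0] fun p ↦ p.2 := by
    simpa using (isBigO_refl (fun p : ℝ × ℝ ↦ p.2) (𝓝 0)).smul (hPfst.isBigO_one ℝ)
  have hlin : (fun p : ℝ × ℝ ↦ p.2 • A' (P p.1 - P 0)) =o[𝓝 0] fun p ↦ p.2 := by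
    have hzero : Tendsto (fun p : ℝ × ℝ ↦ A' (P p.1 - P 0)) (𝓝 0) (𝓝 0) := by
      simpa [Function.comp_def] using (A'.continuous.tendsto _).comp (hPfst.sub_const (P 0))
    simpa using (isBigO_refl (fun p : ℝ × ℝ ↦ p.2) (𝓝 0)).smul_isLittleO
      ((isLittleO_one_iff ℝ).2 hzero)
  have hpair : Tendsto (fun p : ℝ × ℝ ↦ (γ p.1 + p.2 • P p.1, γ p.1)) (𝓝 0) (𝓝 (γ 0, γ 0)) :=
    (tendsto_variation hγ hP).prodMk_nhds (hγ.tendsto.comp hfst)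
  have hstrict := (hA.isLittleO.comp_tendsto hpair).trans_isBigO
    (hdiff.congr_left fun p ↦ by simp)
  refine (hstrict.add hlin).congr_left fun p ↦ ?_
  simp [smul_sub]

-- As `X` is only of class `C¹`, the mixed derivative of `X` along `γ t + ε (w + t ∂_w X)` is
-- available in one order only; the variation is chosen so that its `t`-derivative agrees with `X`
-- up to `o(ε)`.
theorem hasDerivWithinAt_fderiv_integralCurve {X : E → E} {γ : ℝ → E} {Ψ' : E →L[ℝ] E}
    (hX : ContDiffAt ℝ 1 X (γ 0)) (hγ : ∀ᶠ t in 𝓝 0, HasDerivAt γ (X (γ t)) t)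
    (hΨ : HasStrictFDerivAt (fun y ↦ fderiv ℝ X y (X y)) Ψ' (γ 0)) (w : E) :
    HasDerivWithinAt (fun t ↦ fderiv ℝ X (γ t) (w + t • fderiv ℝ X (γ 0) w)) (Ψ' w)
      (Set.Ici 0) 0 := by
  set w' := fderiv ℝ X (γ 0) w with hw'
  set P : ℝ → E := fun t ↦ w + t • w' with hP
  have hγ0 : ContinuousAt γ 0 := hγ.self_of_nhds.continuousAt
  have hP0 : ContinuousAt P 0 := by fun_prop
  have hq := tendsto_variation hγ0 hP0
  have hdiff : ∀ᶠ y in 𝓝 (γ 0), DifferentiableAt ℝ X y :=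
    (hX.eventually (by simp)).mono fun y hy ↦ hy.differentiableAt (by simp)
  have hPd : ∀ t, HasDerivAt P w' t := fun t ↦ by
    simpa [hP] using ((hasDerivAt_id t).smul_const w').const_add w
  refine hasDerivWithinAt_of_mixed_isLittleO (f := fun p ↦ X (γ p.1 + p.2 • P p.1))
    (g := fun p ↦ fderiv ℝ X (γ p.1 + p.2 • P p.1) (X (γ p.1) + p.2 • w')) ?_ ?_ ?_
  · have hγfst : ∀ᶠ p in 𝓝 (0 : ℝ × ℝ), HasDerivAt γ (X (γ p.1)) p.1 :=
      (continuousAt_fst (p := (0 : ℝ × ℝ))).eventually hγ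
    filter_upwards [hγfst, hq.eventually hdiff] with p hγp hXp
    exact HasFDerivAt.comp_hasDerivAt (l := X) p.1 hXp.hasFDerivAt
      (hγp.add ((hPd p.1).const_smul p.2))
  · filter_upwards [hγ0.eventually hdiff] with t ht
    have hline : HasDerivAt (fun ε : ℝ ↦ γ t + ε • P t) (P t) 0 := by
      simpa using ((hasDerivAt_id (0 : ℝ)).smul_const (P t)).const_add (γ t)
    exact HasFDerivAt.comp_hasDerivAt_of_eq (l := X) 0 ht.hasFDerivAt hline (by simp)
  · have hbdd : (fun p : ℝ × ℝ ↦ fderiv ℝ X (γ p.1 + p.2 • P p.1)) =O[𝓝 0] fun _ ↦ (1 : ℝ) :=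
      (((hX.fderiv_right (m := 0) (by simp)).continuousAt.tendsto).comp hq).isBigO_one ℝ
    have hrem : (fun p : ℝ × ℝ ↦ fderiv ℝ X (γ p.1 + p.2 • P p.1)
        (X (γ p.1 + p.2 • P p.1) - X (γ p.1) - p.2 • w')) =o[𝓝 0] fun p ↦ p.2 := by
      have hXo := isLittleO_variation (hX.hasStrictFDerivAt (by simp)) hγ0 hP0
      simp only [hP, zero_smul, add_zero, ← hw'] at hXo
      refine IsBigO.trans_isLittleO (g := fun p : ℝ × ℝ ↦ ‖fderiv ℝ X (γ p.1 + p.2 • P p.1)‖ *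
        ‖X (γ p.1 + p.2 • P p.1) - X (γ p.1) - p.2 • w'‖)
        (IsBigO.of_norm_le fun p ↦ ContinuousLinearMap.le_opNorm _ _) ?_
      simpa only [one_mul] using hbdd.norm_left.mul_isLittleO hXo.norm_left
    refine ((isLittleO_variation hΨ hγ0 hP0).sub hrem).congr_left fun p ↦ ?_
    simp only [hP, zero_smul, add_zero, map_sub, map_add]
    abel

theorem hasStrictFDerivAt_fderiv_apply_self {Γ : E → E →L[ℝ] E →L[ℝ] E} {X : E → E} {y : E}
    (hΓ : ContDiffAt ℝ 1 Γ y) (hX : ContDiffAt ℝ 1 X y)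
    (hXX : ∀ᶠ z in 𝓝 y, fderiv ℝ X z (X z) + Γ z (X z) (X z) = 0) :
    ∃ Ψ' : E →L[ℝ] E, HasStrictFDerivAt (fun z ↦ fderiv ℝ X z (X z)) Ψ' y ∧
      ∀ w, Ψ' w = -(fderiv ℝ Γ y w (X y) (X y) + Γ y (fderiv ℝ X y w) (X y) +
        Γ y (X y) (fderiv ℝ X y w)) := by
  have hX' := hX.hasStrictFDerivAt (by simp)
  have hderiv := (((hΓ.hasStrictFDerivAt (by simp)).clm_apply hX').clm_apply hX').neg
  refine ⟨_, hderiv.congr_of_eventuallyEq ?_, fun w ↦ ?_⟩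
  · exact hXX.mono fun z hz ↦ (eq_neg_of_add_eq_zero_left hz).symm
  · simp only [neg_apply, add_apply, ContinuousLinearMap.comp_apply,
      ContinuousLinearMap.flip_apply]
    abel_nf

-- With `Γ` the Christoffel symbols, the hypotheses say `∇_X X = 0` and `∇X = 0` along `γ`, and the
-- conclusion `R(w, X)X = 0`.
theorem curvature_eq_zero_of_parallel_along {Γ : E → E →L[ℝ] E →L[ℝ] E} {X : E → E} {γ : ℝ → E}
    (hΓ : ContDiffAt ℝ 1 Γ (γ 0)) (hsymm : ∀ u w, Γ (γ 0) u w = Γ (γ 0) w u)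
    (hX : ContDiffAt ℝ 1 X (γ 0))
    (hXX : ∀ᶠ y in 𝓝 (γ 0), fderiv ℝ X y (X y) + Γ y (X y) (X y) = 0)
    (hγ : ∀ᶠ t in 𝓝 0, HasDerivAt γ (X (γ t)) t)
    (hpar : ∀ᶠ t in 𝓝 0, ∀ u, fderiv ℝ X (γ t) u + Γ (γ t) u (X (γ t)) = 0) (w : E) :
    fderiv ℝ Γ (γ 0) w (X (γ 0)) (X (γ 0)) - fderiv ℝ Γ (γ 0) (X (γ 0)) w (X (γ 0)) +
      Γ (γ 0) w (Γ (γ 0) (X (γ 0)) (X (γ 0))) - Γ (γ 0) (X (γ 0)) (Γ (γ 0) w (X (γ 0))) = 0 := by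
  set v := X (γ 0) with hv
  set w' := fderiv ℝ X (γ 0) w with hw'
  obtain ⟨Ψ', hΨ, hΨw⟩ := hasStrictFDerivAt_fderiv_apply_self hΓ hX hXX
  have hγ0 : HasDerivAt γ v 0 := hγ.self_of_nhds
  have hnabla : HasDerivWithinAt (fun t ↦ -(Γ (γ t) (w + t • w') (X (γ t)))) (Ψ' w)
      (Set.Ici 0) 0 := by
    have heq := hpar.mono fun t ht ↦ (eq_neg_of_add_eq_zero_left (ht (w + t • w'))).symm
    exact (hasDerivWithinAt_fderiv_integralCurve hX hγ hΨ w).congr_of_eventuallyEq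
      (nhdsWithin_le_nhds heq) heq.self_of_nhds
  have hP : HasDerivAt (fun t : ℝ ↦ w + t • w') w' 0 := by
    simpa using ((hasDerivAt_id (0 : ℝ)).smul_const w').const_add w
  have hΓγ : HasDerivAt (fun t ↦ Γ (γ t)) (fderiv ℝ Γ (γ 0) v) 0 :=
    (hΓ.differentiableAt (by simp)).hasFDerivAt.comp_hasDerivAt 0 hγ0
  have hXγ : HasDerivAt (fun t ↦ X (γ t)) (fderiv ℝ X (γ 0) v) 0 :=
    (hX.differentiableAt (by simp)).hasFDerivAt.comp_hasDerivAt 0 hγ0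
  have heq := (uniqueDiffWithinAt_Ici (0 : ℝ)).eq_deriv _ hnabla
    ((hΓγ.clm_apply hP).clm_apply hXγ).neg.hasDerivWithinAt
  have hw : w' = -(Γ (γ 0) w v) := eq_neg_of_add_eq_zero_left (hpar.self_of_nhds w)
  have hv' : fderiv ℝ X (γ 0) v = -(Γ (γ 0) v v) :=
    eq_neg_of_add_eq_zero_left (hpar.self_of_nhds v)
  simp only [hΨw, ← hv, ← hw', hv', hw, zero_smul, add_zero, map_neg, neg_apply, add_apply,
    hsymm (Γ (γ 0) w v) v] at heq
  rw [← sub_eq_zero.2 (neg_injective heq)]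
  abel

theorem curvature_eq_zero_of_diagonal {R : E → E → E → E}
    (hadd₂ : ∀ u v v' w, R u (v + v') w = R u v w + R u v' w)
    (hadd₃ : ∀ u v w w', R u v (w + w') = R u v w + R u v w')
    (hanti : ∀ u v w, R u v w = -R v u w)
    (hbianchi : ∀ u v w, R u v w + R v w u + R w u v = 0)
    (hdiag : ∀ w v, R w v v = 0) (u v w : E) : R u v w = 0 := by
  have hpol : ∀ a b c, R a b c = -R a c b := fun a b c ↦ by
    have hsum := hdiag a (b + c)
    rw [hadd₂, hadd₃, hadd₃, hdiag, hdiag, zero_add, add_zero] at hsum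
    exact eq_neg_of_add_eq_zero_left hsum
  have hcyc : R v w u = R u v w := by rw [hpol v w u, hanti v u w, neg_neg]
  have hcyc' : R w u v = R u v w := by rw [hanti w u v, hpol u w v, neg_neg]
  have hthree := hbianchi u v w
  rw [hcyc, hcyc'] at hthree
  have hsmul : (3 : ℝ) • R u v w = 0 := by rw [← hthree]; module
  simpa using hsmul

end LocalAnalysis

/-! ### Gradients and Hessians in coordinates -/

section Gradient

variable {E : Type*} [NormedAddCommGroup E] [NormedSpace ℝ E]

/-- The gradient of `f` in coordinates. -/
noncomputable def coordGradient (G : E → E →L[ℝ] E →L[ℝ] ℝ) (f : E → ℝ) (y : E) : E :=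
  (G y).inverse (fderiv ℝ f y)

theorem coordCurvature_smul_smul (G : E → E →L[ℝ] E →L[ℝ] ℝ) (y w v : E) (r : ℝ) :
    coordCurvature G y w (r • v) (r • v) = r ^ 2 • coordCurvature G y w v v := by
  simp only [coordCurvature, map_smul, smul_apply, sq, mul_smul, smul_sub, smul_add]

namespace IsMetricOn

variable {G : E → E →L[ℝ] E →L[ℝ] ℝ} {U : Set E} {y : E} {f : E → ℝ}

theorem repr_orthogonal_basis (h : IsMetricOn G U) (hy : y ∈ U) {ι : Type*}
    (e : Module.Basis ι ℝ E) (he : ∀ i j, i ≠ j → G y (e i) (e j) = 0) (x : E) (i : ι) :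
    e.repr x i = G y x (e i) / G y (e i) (e i) := by
  rw [eq_div_iff (h.pos y hy _ (e.ne_zero i)).ne']
  have hcoord : G y (e i) (e i) • e.coord i = ((G y).flip (e i) : E →ₗ[ℝ] ℝ) := e.ext fun j ↦ by
    obtain rfl | hji := eq_or_ne j i
    · simp
    · simp [Finsupp.single_eq_of_ne' hji, he j i hji]
  simpa [mul_comm] using DFunLike.congr_fun hcoord x

variable [FiniteDimensional ℝ E]

theorem apply_coordGradient (h : IsMetricOn G U) (hy : y ∈ U) (z : E) :
    G y (coordGradient G f y) z = fderiv ℝ f y z :=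
  h.apply_inverse hy _ _

theorem contDiffAt_coordGradient (h : IsMetricOn G U) (hy : y ∈ U) (hf : ContDiffAt ℝ 2 f y) :
    ContDiffAt ℝ 1 (coordGradient G f) y :=
  ((h.contDiffOn_inverse.contDiffAt (h.isOpen.mem_nhds hy)).of_le (by norm_cast)).clm_apply
    (hf.fderiv_right (m := 1) (by norm_num))

theorem hasFDerivAt_coordGradient (h : IsMetricOn G U) (hy : y ∈ U) (hf : ContDiffAt ℝ 2 f y) :
    HasFDerivAt (coordGradient G f) (fderiv ℝ (coordGradient G f) y) y :=
  ((h.contDiffAt_coordGradient hy hf).differentiableAt (by simp)).hasFDerivAt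

-- The derivative of `G(grad f, z) = df(z)`.
theorem apply_fderiv_coordGradient (h : IsMetricOn G U) (hy : y ∈ U) (hf : ContDiffAt ℝ 2 f y)
    (u z : E) :
    G y (fderiv ℝ (coordGradient G f) y u + christoffel G y u (coordGradient G f y)) z =
      coordHessian G f y u z := by
  have hdiff : fderiv ℝ G y u (coordGradient G f y) z +
      G y (fderiv ℝ (coordGradient G f) y u) z = fderiv ℝ (fderiv ℝ f) y u z := by
    have hleft := ((h.differentiableAt hy).hasFDerivAt.clm_apply
      (h.hasFDerivAt_coordGradient hy hf)).clm_apply (hasFDerivAt_const z y)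
    have hright := (hasFDerivAt_fderiv hf).clm_apply (hasFDerivAt_const z y)
    have heq : (fun x ↦ G x (coordGradient G f x) z) =ᶠ[𝓝 y] fun x ↦ fderiv ℝ f x z :=
      (h.eventually_mem hy).mono fun x hx ↦ h.apply_coordGradient hx z
    have happly := congrArg (fun L : E →L[ℝ] ℝ ↦ L u)
      (hleft.unique (hright.congr_of_eventuallyEq heq))
    simpa [add_comm] using happly
  have hchristoffel : fderiv ℝ f y (christoffel G y u z) =
      (1 / 2 : ℝ) * (fderiv ℝ G y u z (coordGradient G f y) +
        fderiv ℝ G y z u (coordGradient G f y) - fderiv ℝ G y (coordGradient G f y) u z) := by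
    rw [← h.apply_coordGradient hy, h.symm y hy, h.apply_christoffel hy]
  rw [map_add, add_apply, h.apply_christoffel hy]
  simp only [coordHessian, sub_apply, ContinuousLinearMap.comp_apply,
    ContinuousLinearMap.compL_apply]
  rw [hchristoffel, h.fderiv_symm hy u z]
  linarith

theorem coordHessian_symm (h : IsMetricOn G U) (hy : y ∈ U) (hf : ContDiffAt ℝ 2 f y) (u z : E) :
    coordHessian G f y u z = coordHessian G f y z u := by
  simp only [coordHessian, sub_apply, ContinuousLinearMap.comp_apply,
    ContinuousLinearMap.compL_apply]
  rw [h.christoffel_symm hy u z, hf.isSymmSndFDerivAt (by simp) u z]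

theorem coordHessian_coordGradient_of_norm_const (h : IsMetricOn G U) (hy : y ∈ U)
    (hf : ContDiffAt ℝ 2 f y) {c : ℝ}
    (hc : ∀ᶠ x in 𝓝 y, G x (coordGradient G f x) (coordGradient G f x) = c) (z : E) :
    coordHessian G f y (coordGradient G f y) z = 0 := by
  have hX := h.hasFDerivAt_coordGradient hy hf
  have hsq := ((h.differentiableAt hy).hasFDerivAt.clm_apply hX).clm_apply hX
  have hconst := (hasFDerivAt_const (𝕜 := ℝ) c y).congr_of_eventuallyEq hc
  have hderiv := congrArg (fun L : E →L[ℝ] ℝ ↦ L z) (hsq.unique hconst)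
  simp only [add_apply, ContinuousLinearMap.comp_apply, ContinuousLinearMap.flip_apply,
    zero_apply] at hderiv
  rw [h.symm y hy (coordGradient G f y)] at hderiv
  rw [h.coordHessian_symm hy hf, ← h.apply_fderiv_coordGradient hy hf, map_add, add_apply,
    h.apply_christoffel hy]
  linarith

theorem fderiv_christoffel_symm (h : IsMetricOn G U) (hy : y ∈ U) (z u w : E) :
    fderiv ℝ (christoffel G) y z u w = fderiv ℝ (christoffel G) y z w u := by
  have hΓ : HasFDerivAt (christoffel G) (fderiv ℝ (christoffel G) y) y :=
    ((h.contDiffAt_christoffel hy).differentiableAt (by simp)).hasFDerivAt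
  have happly : ∀ u w, HasFDerivAt (fun x ↦ christoffel G x u w) _ y := fun u w ↦
    (hΓ.clm_apply (hasFDerivAt_const u y)).clm_apply (hasFDerivAt_const w y)
  have heq : (fun x ↦ christoffel G x u w) =ᶠ[𝓝 y] fun x ↦ christoffel G x w u :=
    (h.eventually_mem hy).mono fun x hx ↦ h.christoffel_symm hx u w
  simpa using congrArg (fun L : E →L[ℝ] E ↦ L z)
    ((happly u w).unique ((happly w u).congr_of_eventuallyEq heq))

theorem coordCurvature_eq_zero_of_diagonal (h : IsMetricOn G U) (hy : y ∈ U)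
    (hdiag : ∀ w v, coordCurvature G y w v v = 0) (u v w : E) : coordCurvature G y u v w = 0 := by
  refine curvature_eq_zero_of_diagonal (R := coordCurvature G y) ?_ ?_ ?_ ?_ hdiag u v w
  · intro u v v' w
    simp only [coordCurvature, map_add, add_apply]
    abel
  · intro u v w w'
    simp only [coordCurvature, map_add]
    abel
  · intro u v w
    simp only [coordCurvature]
    abel
  · intro u v w
    simp only [coordCurvature]
    rw [h.fderiv_christoffel_symm hy u v w, h.fderiv_christoffel_symm hy v w u,
      h.fderiv_christoffel_symm hy w u v, h.christoffel_symm hy v w, h.christoffel_symm hy u v,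
      h.christoffel_symm hy u w]
    abel

theorem coordCurvature_eq_zero_of_eikonal (h : IsMetricOn G U) {γ : ℝ → E} (hy : γ 0 ∈ U)
    (hf : ∀ᶠ x in 𝓝 (γ 0), ContDiffAt ℝ 2 f x)
    (heik : ∀ᶠ x in 𝓝 (γ 0), G x (coordGradient G f x) (coordGradient G f x) = 1)
    (hγ : ∀ᶠ t in 𝓝 0, HasDerivAt γ (-coordGradient G f (γ t)) t)
    (hess : ∀ᶠ t in 𝓝 0, coordHessian G f (γ t) = 0) (w : E) :
    coordCurvature G (γ 0) w (deriv γ 0) (deriv γ 0) = 0 := by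
  have hγc : ContinuousAt γ 0 := hγ.self_of_nhds.continuousAt
  have hnabla : ∀ x ∈ U, ContDiffAt ℝ 2 f x → ∀ u, (∀ z, coordHessian G f x u z = 0) →
      fderiv ℝ (fun x ↦ -coordGradient G f x) x u +
        christoffel G x u (-coordGradient G f x) = 0 := fun x hx hfx u hu ↦ by
    have hzero : fderiv ℝ (coordGradient G f) x u + christoffel G x u (coordGradient G f x) = 0 :=
      h.eq_of_forall hx fun z ↦ by
        rw [h.apply_fderiv_coordGradient hx hfx, hu, map_zero, zero_apply]
    rw [fderiv_fun_neg, neg_apply, map_neg, ← neg_add, hzero, neg_zero]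
  have hgeod : ∀ᶠ x in 𝓝 (γ 0), fderiv ℝ (fun x ↦ -coordGradient G f x) x (-coordGradient G f x) +
      christoffel G x (-coordGradient G f x) (-coordGradient G f x) = 0 := by
    filter_upwards [hf, eventually_eventually_nhds.2 heik, h.eventually_mem hy] with x hfx hx hxU
    refine hnabla x hxU hfx _ fun z ↦ ?_
    rw [map_neg, neg_apply, h.coordHessian_coordGradient_of_norm_const hxU hfx hx, neg_zero]
  have hpar : ∀ᶠ t in 𝓝 0, ∀ u, fderiv ℝ (fun x ↦ -coordGradient G f x) (γ t) u +
      christoffel G (γ t) u (-coordGradient G f (γ t)) = 0 := by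
    filter_upwards [hγc.eventually hf, hess, hγc.eventually (h.eventually_mem hy)]
      with t hft ht htU u
    exact hnabla _ htU hft u fun z ↦ by rw [ht, zero_apply, zero_apply]
  rw [hγ.self_of_nhds.deriv]
  exact curvature_eq_zero_of_parallel_along ((h.contDiffAt_christoffel hy).of_le (by norm_cast))
    (h.christoffel_symm hy) (h.contDiffAt_coordGradient hy hf.self_of_nhds).neg hgeod hγ hpar w

theorem trace_inverse_comp_eq_sum (h : IsMetricOn G U) (hy : y ∈ U) {ι : Type*} [Fintype ι]
    (e : Module.Basis ι ℝ E) (he : ∀ i j, i ≠ j → G y (e i) (e j) = 0) (H : E →L[ℝ] E →L[ℝ] ℝ) :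
    LinearMap.trace ℝ E (((G y).inverse ∘L H : E →L[ℝ] E) : E →ₗ[ℝ] E) =
      ∑ i, H (e i) (e i) / G y (e i) (e i) := by
  classical
  rw [LinearMap.trace_eq_matrix_trace ℝ e, Matrix.trace]
  refine Finset.sum_congr rfl fun i _ ↦ ?_
  rw [Matrix.diag_apply, LinearMap.toMatrix_apply, h.repr_orthogonal_basis hy e he]
  simp [h.apply_inverse hy]

theorem eq_zero_of_nonneg_of_trace_nonpos (h : IsMetricOn G U) (hy : y ∈ U)
    {H : E →L[ℝ] E →L[ℝ] ℝ} (hsymm : ∀ u w, H u w = H w u) (hpos : ∀ u, 0 ≤ H u u)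
    (htr : LinearMap.trace ℝ E (((G y).inverse ∘L H : E →L[ℝ] E) : E →ₗ[ℝ] E) ≤ 0) : H = 0 := by
  obtain ⟨e, he⟩ := LinearMap.BilinForm.exists_orthogonal_basis
    (B := (ContinuousLinearMap.coeLM ℝ).comp (G y : E →ₗ[ℝ] (E →L[ℝ] ℝ)))
    ⟨fun u w ↦ h.symm y hy u w⟩
  have hpe : ∀ i, 0 < G y (e i) (e i) := fun i ↦ h.pos y hy _ (e.ne_zero i)
  have hquot : ∀ i, 0 ≤ H (e i) (e i) / G y (e i) (e i) :=
    fun i ↦ div_nonneg (hpos _) (hpe i).le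
  rw [h.trace_inverse_comp_eq_sum hy e fun i j hij ↦ he hij] at htr
  have hdiag : ∀ i, H (e i) (e i) = 0 := fun i ↦
    (div_eq_zero_iff.1 ((Finset.sum_eq_zero_iff_of_nonneg fun i _ ↦ hquot i).1
      (htr.antisymm (Finset.sum_nonneg fun i _ ↦ hquot i)) i (Finset.mem_univ i))).resolve_right
      (hpe i).ne'
  have hker : ∀ i w, H w (e i) = 0 := fun i w ↦ by
    have hcs := LinearMap.BilinForm.apply_mul_apply_le_of_forall_zero_le
      ((ContinuousLinearMap.coeLM ℝ).comp (H : E →ₗ[ℝ] (E →L[ℝ] ℝ))) hpos w (e i)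
    have hsq : H w (e i) * H w (e i) ≤ 0 := by
      calc H w (e i) * H w (e i) = H w (e i) * H (e i) w := by rw [hsymm (e i) w]
        _ ≤ H w w * H (e i) (e i) := hcs
        _ = 0 := by rw [hdiag, mul_zero]
    exact mul_self_eq_zero.1 (hsq.antisymm (mul_self_nonneg _))
  ext u : 1
  exact ContinuousLinearMap.coe_injective (e.ext fun i ↦ hker i u)

end IsMetricOn

theorem deriv_deriv_nonneg_of_isLocalMin {g : ℝ → ℝ} {a : ℝ} (hg : IsLocalMin g a)
    (hc : ContinuousAt g a) : 0 ≤ deriv (deriv g) a := by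
  by_contra! hneg
  have hmax : IsLocalMax g a := isLocalMax_of_deriv_deriv_neg hneg hg.deriv_eq_zero hc
  have hconst : g =ᶠ[𝓝 a] fun _ ↦ g a := by
    filter_upwards [hg, hmax] with x hmin hmax using le_antisymm hmax hmin
  have hzero : deriv (deriv g) a = 0 := by
    rw [hconst.deriv.deriv_eq, deriv_const', deriv_const]
  exact hneg.ne hzero

theorem fderiv_fderiv_nonneg_of_isLocalMin {f : E → ℝ} {y : E} (hf : IsLocalMin f y)
    (hd : ContDiffAt ℝ 2 f y) (u : E) : 0 ≤ fderiv ℝ (fderiv ℝ f) y u u := by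
  have hline : ∀ s : ℝ, HasDerivAt (fun s : ℝ ↦ y + s • u) u s := fun s ↦ by
    simpa using ((hasDerivAt_id s).smul_const u).const_add y
  have htend : Tendsto (fun s : ℝ ↦ y + s • u) (𝓝 0) (𝓝 y) := by
    simpa using (hline 0).continuousAt.tendsto
  have hfst : deriv (fun s : ℝ ↦ f (y + s • u)) =ᶠ[𝓝 0] fun s ↦ fderiv ℝ f (y + s • u) u := by
    filter_upwards [htend.eventually (hd.eventually (by simp))] with s hs
    exact (HasFDerivAt.comp_hasDerivAt (l := f) s (hs.differentiableAt (by simp)).hasFDerivAt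
      (hline s)).deriv
  have hsnd : HasDerivAt (fun s : ℝ ↦ fderiv ℝ f (y + s • u) u)
      (fderiv ℝ (fderiv ℝ f) y u u) 0 := by
    simpa using ((hasFDerivAt_fderiv hd).comp_hasDerivAt_of_eq 0 (hline 0) (by simp)).clm_apply
      (hasDerivAt_const 0 u)
  rw [← hsnd.deriv, ← hfst.deriv_eq]
  refine deriv_deriv_nonneg_of_isLocalMin ?_ ?_
  · simpa [IsLocalMin, IsMinFilter] using htend.eventually hf
  · simpa [ContinuousAt, Function.comp_def] using hd.continuousAt.tendsto.comp htend

end Gradient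

/-! ### The metric in charts -/

section Charts

variable {E : Type*} [NormedAddCommGroup E] [NormedSpace ℝ E]
  {M : Type*} [TopologicalSpace M] [ChartedSpace E M] [IsManifold 𝓘(ℝ, E) ∞ M]

theorem contMDiffAt_extChartAt_symm {c : M} {y : E} (hy : y ∈ (extChartAt 𝓘(ℝ, E) c).target) :
    ContMDiffAt 𝓘(ℝ, E) 𝓘(ℝ, E) ∞ (extChartAt 𝓘(ℝ, E) c).symm y :=
  (contMDiffOn_extChartAt_symm c).contMDiffAt (extChartAt_target_mem_nhds' hy)

theorem contMDiffAt_extChartAt_of_mem {c x : M} (hx : x ∈ (extChartAt 𝓘(ℝ, E) c).source) :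
    ContMDiffAt 𝓘(ℝ, E) 𝓘(ℝ, E) ∞ (extChartAt 𝓘(ℝ, E) c) x :=
  contMDiffAt_extChartAt' (by simpa using hx)

theorem mdifferentiableAt_extChartAt_of_mem {c x : M} (hx : x ∈ (extChartAt 𝓘(ℝ, E) c).source) :
    MDifferentiableAt 𝓘(ℝ, E) 𝓘(ℝ, E) (extChartAt 𝓘(ℝ, E) c) x :=
  (contMDiffAt_extChartAt_of_mem hx).mdifferentiableAt (by simp)

theorem mfderiv_symm_coord {c : M} {y : E} (hy : y ∈ (extChartAt 𝓘(ℝ, E) c).target)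
    (u : TangentSpace 𝓘(ℝ, E) ((extChartAt 𝓘(ℝ, E) c).symm y)) :
    mfderiv 𝓘(ℝ, E) 𝓘(ℝ, E) (extChartAt 𝓘(ℝ, E) c).symm y
      (coord (E := E) c ((extChartAt 𝓘(ℝ, E) c).symm y) u) = u := by
  have := IsManifold.of_le (I := 𝓘(ℝ, E)) (M := M) (m := 1) (n := ∞) (by norm_cast)
  have h := mfderivWithin_extChartAt_symm_comp_mfderiv_extChartAt (I := 𝓘(ℝ, E)) (x := c) hy
  rw [modelWithCornersSelf_coe, Set.range_id, mfderivWithin_univ] at h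
  exact congrArg (fun L ↦ L u) h

theorem coord_mfderiv_symm {c : M} {y : E} (hy : y ∈ (extChartAt 𝓘(ℝ, E) c).target) (u : E) :
    coord c ((extChartAt 𝓘(ℝ, E) c).symm y)
      (mfderiv 𝓘(ℝ, E) 𝓘(ℝ, E) (extChartAt 𝓘(ℝ, E) c).symm y u) = u := by
  have := IsManifold.of_le (I := 𝓘(ℝ, E)) (M := M) (m := 1) (n := ∞) (by norm_cast)
  have h := mfderiv_extChartAt_comp_mfderivWithin_extChartAt_symm (I := 𝓘(ℝ, E)) (x := c) hy
  rw [modelWithCornersSelf_coe, Set.range_id, mfderivWithin_univ] at h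
  exact congrArg (fun L ↦ L u) h

theorem isInvertible_coord {c x : M} (hx : x ∈ (extChartAt 𝓘(ℝ, E) c).source) :
    (coord (E := E) c x).IsInvertible := by
  have := IsManifold.of_le (I := 𝓘(ℝ, E)) (M := M) (m := 1) (n := ∞) (by norm_cast)
  exact isInvertible_mfderiv_extChartAt hx

theorem surjective_coord {c x : M} (hx : x ∈ (extChartAt 𝓘(ℝ, E) c).source) :
    Function.Surjective (coord (E := E) c x) := by
  obtain ⟨e, he⟩ := isInvertible_coord hx
  exact he ▸ e.surjective

theorem contMDiffOn_mfderiv_extChartAt_symm (c : M) (u : E) :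
    ContMDiffOn 𝓘(ℝ, E) 𝓘(ℝ, E).tangent ∞
      (fun y ↦ (⟨(extChartAt 𝓘(ℝ, E) c).symm y,
        mfderiv 𝓘(ℝ, E) 𝓘(ℝ, E) (extChartAt 𝓘(ℝ, E) c).symm y u⟩ : TangentBundle 𝓘(ℝ, E) M))
      (extChartAt 𝓘(ℝ, E) c).target := by
  have htangent := (contMDiffOn_extChartAt_symm (I := 𝓘(ℝ, E)) (n := ∞) c
    ).contMDiffOn_tangentMapWithin (m := ∞) (by simp) (isOpen_extChartAt_target c).uniqueMDiffOn
  have hconst : ContMDiff 𝓘(ℝ, E) 𝓘(ℝ, E).tangent ∞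
      (fun y : E ↦ (⟨y, u⟩ : TangentBundle 𝓘(ℝ, E) E)) :=
    contMDiff_vectorSpace_iff_contDiff.2 contDiff_const
  refine (htangent.comp hconst.contMDiffOn (s := (extChartAt 𝓘(ℝ, E) c).target)
    fun y hy ↦ hy).congr fun y hy ↦ ?_
  simp only [Function.comp_apply, tangentMapWithin]
  rw [mfderivWithin_of_isOpen (isOpen_extChartAt_target c) hy]

theorem contDiffAt_comp_extChartAt_symm {f : M → ℝ} {c x : M}
    (hf : ContMDiffAt 𝓘(ℝ, E) 𝓘(ℝ, ℝ) 2 f x) (hx : x ∈ (extChartAt 𝓘(ℝ, E) c).source) :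
    ContDiffAt ℝ 2 (f ∘ (extChartAt 𝓘(ℝ, E) c).symm) (extChartAt 𝓘(ℝ, E) c x) := by
  rw [← contMDiffAt_iff_contDiffAt]
  exact ContMDiffAt.comp _ (by rwa [(extChartAt 𝓘(ℝ, E) c).left_inv hx])
    ((contMDiffAt_extChartAt_symm ((extChartAt 𝓘(ℝ, E) c).map_source hx)).of_le (by norm_cast))

variable [RiemannianBundle (fun x : M ↦ TangentSpace 𝓘(ℝ, E) x)]

theorem chartMetric_coord {c x : M} (hx : x ∈ (extChartAt 𝓘(ℝ, E) c).source)
    (u w : TangentSpace 𝓘(ℝ, E) x) :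
    chartMetric c (extChartAt 𝓘(ℝ, E) c x) (coord c x u) (coord c x w) = inner ℝ u w := by
  obtain ⟨y, hy, rfl⟩ : ∃ y ∈ (extChartAt 𝓘(ℝ, E) c).target,
      (extChartAt 𝓘(ℝ, E) c).symm y = x :=
    ⟨_, (extChartAt 𝓘(ℝ, E) c).map_source hx, (extChartAt 𝓘(ℝ, E) c).left_inv hx⟩
  rw [(extChartAt 𝓘(ℝ, E) c).right_inv hy]
  change inner ℝ (mfderiv 𝓘(ℝ, E) 𝓘(ℝ, E) (extChartAt 𝓘(ℝ, E) c).symm y _)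
    (mfderiv 𝓘(ℝ, E) 𝓘(ℝ, E) (extChartAt 𝓘(ℝ, E) c).symm y _) = _
  rw [mfderiv_symm_coord hy, mfderiv_symm_coord hy]

variable [FiniteDimensional ℝ E]
  [IsContMDiffRiemannianBundle 𝓘(ℝ, E) ∞ E (fun x : M ↦ TangentSpace 𝓘(ℝ, E) x)]

theorem isMetricOn_chartMetric (c : M) :
    IsMetricOn (chartMetric (E := E) c) (extChartAt 𝓘(ℝ, E) c).target where
  isOpen := isOpen_extChartAt_target c
  symm y _ u w := real_inner_comm (F := TangentSpace 𝓘(ℝ, E) ((extChartAt 𝓘(ℝ, E) c).symm y)) _ _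
  pos y hy u hu := by
    refine (real_inner_self_pos (F := TangentSpace 𝓘(ℝ, E) ((extChartAt 𝓘(ℝ, E) c).symm y))).2
      fun h0 ↦ hu ?_
    exact (coord_mfderiv_symm hy u).symm.trans
      ((congrArg (coord c ((extChartAt 𝓘(ℝ, E) c).symm y)) h0).trans (map_zero _))
  contDiffOn := by
    refine contDiffOn_clm_apply.2 fun u ↦ contDiffOn_clm_apply.2 fun w ↦ ?_
    rw [← contMDiffOn_iff_contDiffOn]
    exact ContMDiffOn.inner_bundle (F := E) (E := fun x : M ↦ TangentSpace 𝓘(ℝ, E) x)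
      (contMDiffOn_mfderiv_extChartAt_symm c u) (contMDiffOn_mfderiv_extChartAt_symm c w)

end Charts

/-! ### Isometries -/

section Isometries

variable {E : Type*} [NormedAddCommGroup E] [NormedSpace ℝ E]
  {M : Type*} [TopologicalSpace M] [ChartedSpace E M]

variable (E) in
/-- The map `s` read in the charts centred at `c` and `c'`. -/
noncomputable def chartMap (c c' : M) (s : M → M) : E → E :=
  extChartAt 𝓘(ℝ, E) c' ∘ s ∘ (extChartAt 𝓘(ℝ, E) c).symm

section ChartMap

variable {c c' x : M} {s : M → M}

theorem chartMap_extChartAt (hx : x ∈ (extChartAt 𝓘(ℝ, E) c).source) :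
    chartMap E c c' s (extChartAt 𝓘(ℝ, E) c x) = extChartAt 𝓘(ℝ, E) c' (s x) := by
  simp only [chartMap, Function.comp_apply, (extChartAt 𝓘(ℝ, E) c).left_inv hx]

theorem eventually_map_symm_mem_source (hs : Continuous s)
    (hx : x ∈ (extChartAt 𝓘(ℝ, E) c).source) (hx' : s x ∈ (extChartAt 𝓘(ℝ, E) c').source) :
    ∀ᶠ y in 𝓝 (extChartAt 𝓘(ℝ, E) c x),
      s ((extChartAt 𝓘(ℝ, E) c).symm y) ∈ (extChartAt 𝓘(ℝ, E) c').source := by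
  have hcont : ContinuousAt (s ∘ (extChartAt 𝓘(ℝ, E) c).symm) (extChartAt 𝓘(ℝ, E) c x) :=
    hs.continuousAt.comp (continuousAt_extChartAt_symm'' ((extChartAt 𝓘(ℝ, E) c).map_source hx))
  refine hcont.eventually ((isOpen_extChartAt_source c').mem_nhds ?_)
  rwa [Function.comp_apply, (extChartAt 𝓘(ℝ, E) c).left_inv hx]

variable [IsManifold 𝓘(ℝ, E) ∞ M]

theorem contDiffAt_chartMap (hs : ContMDiff 𝓘(ℝ, E) 𝓘(ℝ, E) ∞ s)
    (hx : x ∈ (extChartAt 𝓘(ℝ, E) c).source) (hx' : s x ∈ (extChartAt 𝓘(ℝ, E) c').source) :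
    ContDiffAt ℝ ∞ (chartMap E c c' s) (extChartAt 𝓘(ℝ, E) c x) := by
  have hinv := (extChartAt 𝓘(ℝ, E) c).left_inv hx
  rw [← contMDiffAt_iff_contDiffAt]
  exact (contMDiffAt_extChartAt_of_mem (by rwa [Function.comp_apply, hinv])).comp _
    ((hs _).comp _ (contMDiffAt_extChartAt_symm ((extChartAt 𝓘(ℝ, E) c).map_source hx)))

theorem fderiv_chartMap_coord (hs : ContMDiff 𝓘(ℝ, E) 𝓘(ℝ, E) ∞ s)
    (hx : x ∈ (extChartAt 𝓘(ℝ, E) c).source) (hx' : s x ∈ (extChartAt 𝓘(ℝ, E) c').source)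
    (u : TangentSpace 𝓘(ℝ, E) x) :
    fderiv ℝ (chartMap E c c' s) (extChartAt 𝓘(ℝ, E) c x) (coord c x u) =
      coord c' (s x) (mfderiv 𝓘(ℝ, E) 𝓘(ℝ, E) s x u) := by
  have hchart : MDifferentiableAt 𝓘(ℝ, E) 𝓘(ℝ, E) (chartMap E c c' s)
      (extChartAt 𝓘(ℝ, E) c x) :=
    ((contDiffAt_chartMap hs hx hx').differentiableAt (by simp)).mdifferentiableAt
  have hleft := hchart.hasMFDerivAt.comp x (mdifferentiableAt_extChartAt_of_mem hx).hasMFDerivAt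
  have hright := (mdifferentiableAt_extChartAt_of_mem hx').hasMFDerivAt.comp x
    ((hs x).mdifferentiableAt (by simp)).hasMFDerivAt
  have hconj : extChartAt 𝓘(ℝ, E) c' ∘ s =ᶠ[𝓝 x]
      chartMap E c c' s ∘ extChartAt 𝓘(ℝ, E) c := by
    filter_upwards [extChartAt_source_mem_nhds' hx] with z hz
    exact (chartMap_extChartAt hz).symm
  rw [← mfderiv_eq_fderiv]
  exact congrArg (fun L ↦ L u)
    (hasMFDerivAt_unique (hleft.congr_of_eventuallyEq hconj) hright)

end ChartMap

variable [RiemannianBundle (fun x : M ↦ TangentSpace 𝓘(ℝ, E) x)]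

variable (E) in
/-- Smooth maps preserving the Riemannian metric. -/
structure IsRiemannianIsometry (s : M → M) : Prop where
  contMDiff : ContMDiff 𝓘(ℝ, E) 𝓘(ℝ, E) ∞ s
  inner_mfderiv : ∀ (x : M) (u w : TangentSpace 𝓘(ℝ, E) x),
    inner ℝ (mfderiv 𝓘(ℝ, E) 𝓘(ℝ, E) s x u) (mfderiv 𝓘(ℝ, E) 𝓘(ℝ, E) s x w) = inner ℝ u w

namespace IsRiemannianIsometry

theorem id : IsRiemannianIsometry E (fun x : M ↦ x) where
  contMDiff := contMDiff_id
  inner_mfderiv x u w := by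
    have hid : mfderiv 𝓘(ℝ, E) 𝓘(ℝ, E) (fun x : M ↦ x) x = ContinuousLinearMap.id ℝ _ :=
      mfderiv_id
    rw [hid]
    rfl

variable {s s' : M → M}

theorem comp (hs : IsRiemannianIsometry E s) (hs' : IsRiemannianIsometry E s') :
    IsRiemannianIsometry E (s ∘ s') where
  contMDiff := hs.contMDiff.comp hs'.contMDiff
  inner_mfderiv x u w := by
    rw [mfderiv_comp x ((hs.contMDiff _).mdifferentiableAt (by simp))
      ((hs'.contMDiff _).mdifferentiableAt (by simp))]
    exact (hs.inner_mfderiv _ _ _).trans (hs'.inner_mfderiv _ _ _)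

theorem norm_mfderiv (hs : IsRiemannianIsometry E s) (x : M) (u : TangentSpace 𝓘(ℝ, E) x) :
    ‖mfderiv 𝓘(ℝ, E) 𝓘(ℝ, E) s x u‖ = ‖u‖ := by
  rw [@norm_eq_sqrt_real_inner (TangentSpace 𝓘(ℝ, E) (s x)),
    @norm_eq_sqrt_real_inner (TangentSpace 𝓘(ℝ, E) x), hs.inner_mfderiv]

end IsRiemannianIsometry

variable [IsManifold 𝓘(ℝ, E) ∞ M]

namespace IsRiemannianIsometry

variable {s : M → M} {c c' x : M}

theorem isLocalIsometryAt_chartMap (hs : IsRiemannianIsometry E s)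
    (hx : x ∈ (extChartAt 𝓘(ℝ, E) c).source) (hx' : s x ∈ (extChartAt 𝓘(ℝ, E) c').source) :
    IsLocalIsometryAt (chartMetric c) (chartMetric c') (chartMap E c c' s)
      (extChartAt 𝓘(ℝ, E) c x) where
  contDiffAt := (contDiffAt_chartMap hs.contMDiff hx hx').of_le (by norm_cast)
  eventually_pullback_eq := by
    have hy := (extChartAt 𝓘(ℝ, E) c).map_source hx
    filter_upwards [extChartAt_target_mem_nhds' hy,
      eventually_map_symm_mem_source hs.contMDiff.continuous hx hx'] with y hyc hyc' u' w'
    obtain ⟨z, hz, rfl⟩ : ∃ z ∈ (extChartAt 𝓘(ℝ, E) c).source, extChartAt 𝓘(ℝ, E) c z = y :=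
      ⟨_, (extChartAt 𝓘(ℝ, E) c).map_target hyc, (extChartAt 𝓘(ℝ, E) c).right_inv hyc⟩
    rw [(extChartAt 𝓘(ℝ, E) c).left_inv hz] at hyc'
    obtain ⟨u, rfl⟩ := surjective_coord hz u'
    obtain ⟨w, rfl⟩ := surjective_coord hz w'
    rw [fderiv_chartMap_coord hs.contMDiff hz hyc', fderiv_chartMap_coord hs.contMDiff hz hyc',
      chartMap_extChartAt hz, chartMetric_coord hyc', chartMetric_coord hz]
    exact hs.inner_mfderiv z u w

variable [FiniteDimensional ℝ E]
  [IsContMDiffRiemannianBundle 𝓘(ℝ, E) ∞ E (fun x : M ↦ TangentSpace 𝓘(ℝ, E) x)]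

theorem coordHessian_comp (hs : IsRiemannianIsometry E s)
    (hx : x ∈ (extChartAt 𝓘(ℝ, E) c).source) (hx' : s x ∈ (extChartAt 𝓘(ℝ, E) c').source)
    {f : M → ℝ} (hf : ContMDiffAt 𝓘(ℝ, E) 𝓘(ℝ, ℝ) 2 f (s x)) (u w : TangentSpace 𝓘(ℝ, E) x) :
    coordHessian (chartMetric c) ((f ∘ s) ∘ (extChartAt 𝓘(ℝ, E) c).symm)
        (extChartAt 𝓘(ℝ, E) c x) (coord c x u) (coord c x w) =
      coordHessian (chartMetric c') (f ∘ (extChartAt 𝓘(ℝ, E) c').symm)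
        (extChartAt 𝓘(ℝ, E) c' (s x)) (coord c' (s x) (mfderiv 𝓘(ℝ, E) 𝓘(ℝ, E) s x u))
        (coord c' (s x) (mfderiv 𝓘(ℝ, E) 𝓘(ℝ, E) s x w)) := by
  have hy := (extChartAt 𝓘(ℝ, E) c).map_source hx
  have hFx := chartMap_extChartAt (c' := c') (s := s) hx
  have hf' := contDiffAt_comp_extChartAt_symm hf hx'
  have hconj : (f ∘ s) ∘ (extChartAt 𝓘(ℝ, E) c).symm =ᶠ[𝓝 (extChartAt 𝓘(ℝ, E) c x)]
      (f ∘ (extChartAt 𝓘(ℝ, E) c').symm) ∘ chartMap E c c' s := by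
    filter_upwards [eventually_map_symm_mem_source hs.contMDiff.continuous hx hx'] with y hyc'
    simp only [chartMap, Function.comp_apply, (extChartAt 𝓘(ℝ, E) c').left_inv hyc']
  rw [coordHessian_congr hconj, (hs.isLocalIsometryAt_chartMap hx hx').coordHessian_comp
    (isMetricOn_chartMetric c) hy (isMetricOn_chartMetric c')
    (hFx ▸ (extChartAt 𝓘(ℝ, E) c').map_source hx') (hFx ▸ hf'), hFx,
    fderiv_chartMap_coord hs.contMDiff hx hx', fderiv_chartMap_coord hs.contMDiff hx hx']

end IsRiemannianIsometry

end Isometries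

/-! ### Geodesics -/

section GeodesicEquation

variable {E : Type*} [NormedAddCommGroup E] [NormedSpace ℝ E]

theorem coordAccel_congr {G : E → E →L[ℝ] E →L[ℝ] ℝ} {y y' : ℝ → E} {t : ℝ} (h : y =ᶠ[𝓝 t] y') :
    coordAccel G y t = coordAccel G y' t := by
  rw [coordAccel, coordAccel, h.deriv.deriv_eq, h.deriv_eq, h.self_of_nhds]

theorem coordAccel_comp_add (G : E → E →L[ℝ] E →L[ℝ] ℝ) (y : ℝ → E) (a t : ℝ) :
    coordAccel G (fun s ↦ y (s + a)) t = coordAccel G y (t + a) := by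
  have hderiv (f : ℝ → E) : deriv (fun s ↦ f (s + a)) = fun s ↦ deriv f (s + a) :=
    funext fun s ↦ deriv_comp_add_const f a s
  simp only [coordAccel, hderiv]

theorem coordAccel_comp_neg (G : E → E →L[ℝ] E →L[ℝ] ℝ) (y : ℝ → E) (t : ℝ) :
    coordAccel G (fun s ↦ y (-s)) t = coordAccel G y (-t) := by
  have hderiv (f : ℝ → E) : deriv (fun s ↦ f (-s)) = fun s ↦ -deriv f (-s) :=
    funext fun s ↦ deriv_comp_neg f s
  simp only [coordAccel, hderiv, deriv.fun_neg, map_neg, neg_neg, neg_apply]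

variable {M : Type*} [TopologicalSpace M] [ChartedSpace E M]

section Smooth

variable [IsManifold 𝓘(ℝ, E) ∞ M]

theorem contDiffAt_extChartAt_comp {γ : ℝ → M} {t : ℝ} {c : M} {n : WithTop ℕ∞} (hn : n ≤ ∞)
    (hγ : ContMDiffAt 𝓘(ℝ, ℝ) 𝓘(ℝ, E) n γ t) (hc : γ t ∈ (extChartAt 𝓘(ℝ, E) c).source) :
    ContDiffAt ℝ n (extChartAt 𝓘(ℝ, E) c ∘ γ) t := by
  rw [← contMDiffAt_iff_contDiffAt]
  exact ((contMDiffAt_extChartAt_of_mem hc).of_le hn).comp t hγ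

theorem coord_velocity {γ : ℝ → M} {t : ℝ} {c : M}
    (hγ : MDifferentiableAt 𝓘(ℝ, ℝ) 𝓘(ℝ, E) γ t) (hc : γ t ∈ (extChartAt 𝓘(ℝ, E) c).source) :
    coord c (γ t) (velocity E γ t) = deriv (extChartAt 𝓘(ℝ, E) c ∘ γ) t := by
  have h := ((mdifferentiableAt_extChartAt_of_mem hc).hasMFDerivAt.comp t hγ.hasMFDerivAt).mfderiv
  rw [← fderiv_apply_one_eq_deriv, ← mfderiv_eq_fderiv]
  exact (congrArg (fun L ↦ L (1 : ℝ)) h).symm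

end Smooth

variable [RiemannianBundle (fun x : M ↦ TangentSpace 𝓘(ℝ, E) x)]

variable (E) in
/-- `γ` is smooth at `t` and satisfies the geodesic equation at `t`. Geodesics defined on an
interval are curves with this property at every parameter of the interval. -/
structure IsGeodesicAt (γ : ℝ → M) (t : ℝ) : Prop where
  contMDiffAt : ContMDiffAt 𝓘(ℝ, ℝ) 𝓘(ℝ, E) ∞ γ t
  coordAccel_eq_zero : coordAccel (chartMetric (γ t)) (extChartAt 𝓘(ℝ, E) (γ t) ∘ γ) t = 0

namespace IsGeodesicAt

variable {γ γ' : ℝ → M} {t a : ℝ}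

theorem congr (h : IsGeodesicAt E γ t) (heq : γ' =ᶠ[𝓝 t] γ) : IsGeodesicAt E γ' t where
  contMDiffAt := h.contMDiffAt.congr_of_eventuallyEq heq
  coordAccel_eq_zero := by
    rw [heq.self_of_nhds, coordAccel_congr (heq.fun_comp _)]
    exact h.coordAccel_eq_zero

theorem comp_add (h : IsGeodesicAt E γ (t + a)) : IsGeodesicAt E (fun s ↦ γ (s + a)) t where
  contMDiffAt := by
    have hadd : ContMDiff 𝓘(ℝ, ℝ) 𝓘(ℝ, ℝ) ∞ (fun s : ℝ ↦ s + a) := by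
      rw [contMDiff_iff_contDiff]
      fun_prop
    exact ContMDiffAt.comp t (g := γ) (f := fun s : ℝ ↦ s + a) h.contMDiffAt (hadd t)
  coordAccel_eq_zero := (coordAccel_comp_add _ (_ ∘ γ) a t).trans h.coordAccel_eq_zero

theorem comp_neg (h : IsGeodesicAt E γ (-t)) : IsGeodesicAt E (fun s ↦ γ (-s)) t where
  contMDiffAt := by
    have hneg : ContMDiff 𝓘(ℝ, ℝ) 𝓘(ℝ, ℝ) ∞ (fun s : ℝ ↦ -s) := by
      rw [contMDiff_iff_contDiff]
      fun_prop
    exact ContMDiffAt.comp t (g := γ) (f := fun s : ℝ ↦ -s) h.contMDiffAt (hneg t)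
  coordAccel_eq_zero := (coordAccel_comp_neg _ (_ ∘ γ) t).trans h.coordAccel_eq_zero

end IsGeodesicAt

variable [IsManifold 𝓘(ℝ, E) ∞ M]

theorem covDerivAlong_velocity_eq_zero_iff {γ : ℝ → M} {t : ℝ}
    (hγ : ContMDiffAt 𝓘(ℝ, ℝ) 𝓘(ℝ, E) ∞ γ t) :
    covDerivAlong γ (velocity E γ) t = 0 ↔
      coordAccel (chartMetric (γ t)) (extChartAt 𝓘(ℝ, E) (γ t) ∘ γ) t = 0 := by
  have hγ₁ : ContMDiffAt 𝓘(ℝ, ℝ) 𝓘(ℝ, E) 1 γ t := hγ.of_le (by norm_cast)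
  have hvel : (fun s ↦ coord (γ t) (γ s) (velocity E γ s)) =ᶠ[𝓝 t]
      deriv (extChartAt 𝓘(ℝ, E) (γ t) ∘ γ) := by
    filter_upwards [hγ.continuousAt.eventually (extChartAt_source_mem_nhds (I := 𝓘(ℝ, E)) (γ t)),
      (contMDiffAt_iff_contMDiffAt_nhds (by simp)).1 hγ₁] with s hsrc hs
    exact coord_velocity (hs.mdifferentiableAt (by simp)) hsrc
  have hinv := isInvertible_coord (E := E) (mem_extChartAt_source (I := 𝓘(ℝ, E)) (γ t))
  rw [covDerivAlong, hinv.inverse_apply_eq, map_zero, hvel.deriv_eq,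
    show coord (γ t) (γ t) (velocity E γ t) = _ from hvel.self_of_nhds]
  rfl

variable [FiniteDimensional ℝ E]
  [IsContMDiffRiemannianBundle 𝓘(ℝ, E) ∞ E (fun x : M ↦ TangentSpace 𝓘(ℝ, E) x)]

theorem IsRiemannianIsometry.coordAccel_eq_zero {s : M → M} (hs : IsRiemannianIsometry E s)
    {c c' : M} {γ : ℝ → M} {t : ℝ} (hγ : ContMDiffAt 𝓘(ℝ, ℝ) 𝓘(ℝ, E) ∞ γ t)
    (hc : γ t ∈ (extChartAt 𝓘(ℝ, E) c).source) (hc' : s (γ t) ∈ (extChartAt 𝓘(ℝ, E) c').source)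
    (h : coordAccel (chartMetric c) (extChartAt 𝓘(ℝ, E) c ∘ γ) t = 0) :
    coordAccel (chartMetric c') (extChartAt 𝓘(ℝ, E) c' ∘ s ∘ γ) t = 0 := by
  have hconj : extChartAt 𝓘(ℝ, E) c' ∘ s ∘ γ =ᶠ[𝓝 t]
      chartMap E c c' s ∘ (extChartAt 𝓘(ℝ, E) c ∘ γ) := by
    filter_upwards [hγ.continuousAt.eventually (extChartAt_source_mem_nhds' hc)] with r hr
    exact (chartMap_extChartAt hr).symm
  have haccel := (hs.isLocalIsometryAt_chartMap hc hc').coordAccel_comp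
    (y := extChartAt 𝓘(ℝ, E) c ∘ γ) (isMetricOn_chartMetric c)
    ((extChartAt 𝓘(ℝ, E) c).map_source hc) (isMetricOn_chartMetric c')
    (chartMap_extChartAt (s := s) hc ▸ (extChartAt 𝓘(ℝ, E) c').map_source hc')
    ((contDiffAt_extChartAt_comp le_rfl hγ hc).of_le (by norm_cast))
  rw [coordAccel_congr hconj, haccel, h, map_zero]

theorem IsGeodesicAt.comp_isometry {γ : ℝ → M} {t : ℝ} (h : IsGeodesicAt E γ t) {s : M → M}
    (hs : IsRiemannianIsometry E s) : IsGeodesicAt E (s ∘ γ) t where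
  contMDiffAt := (hs.contMDiff _).comp t h.contMDiffAt
  coordAccel_eq_zero := hs.coordAccel_eq_zero h.contMDiffAt (mem_extChartAt_source _)
    (mem_extChartAt_source _) h.coordAccel_eq_zero

theorem isGeodesicAt_iff {γ : ℝ → M} {t : ℝ} {c : M} (hc : γ t ∈ (extChartAt 𝓘(ℝ, E) c).source) :
    IsGeodesicAt E γ t ↔ ContMDiffAt 𝓘(ℝ, ℝ) 𝓘(ℝ, E) ∞ γ t ∧
      coordAccel (chartMetric c) (extChartAt 𝓘(ℝ, E) c ∘ γ) t = 0 :=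
  ⟨fun h ↦ ⟨h.contMDiffAt, IsRiemannianIsometry.id.coordAccel_eq_zero h.contMDiffAt
    (mem_extChartAt_source _) hc h.coordAccel_eq_zero⟩,
   fun h ↦ ⟨h.1, IsRiemannianIsometry.id.coordAccel_eq_zero h.1 hc
    (mem_extChartAt_source _) h.2⟩⟩

end GeodesicEquation

section GeodesicField

variable {E : Type*} [NormedAddCommGroup E] [NormedSpace ℝ E]

theorem contDiffOn_of_hasDerivAt_autonomous {f : E → E} {S : Set E} (hf : ContDiffOn ℝ ∞ f S)
    {α : ℝ → E} {J : Set ℝ} (hJ : IsOpen J) (hα : ∀ t ∈ J, HasDerivAt α (f (α t)) t)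
    (hS : ∀ t ∈ J, α t ∈ S) : ContDiffOn ℝ ∞ α J := by
  refine contDiffOn_infty.2 fun n ↦ ?_
  induction n with
  | zero => exact contDiffOn_zero.2 fun t ht ↦ (hα t ht).continuousAt.continuousWithinAt
  | succ n ih =>
    rw [Nat.cast_succ]
    refine (contDiffOn_succ_iff_deriv_of_isOpen hJ).2
      ⟨fun t ht ↦ (hα t ht).differentiableAt.differentiableWithinAt, by simp, ?_⟩
    have hcomp : ContDiffOn ℝ n (f ∘ α) J := (hf.of_le (by exact_mod_cast le_top)).comp ih hS
    exact hcomp.congr fun t ht ↦ (hα t ht).deriv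

/-- The geodesic equation as a first order equation in phase space. -/
noncomputable def geodesicField (G : E → E →L[ℝ] E →L[ℝ] ℝ) (q : E × E) : E × E :=
  (q.2, -christoffel G q.1 q.2 q.2)

theorem hasDerivAt_phase {G : E → E →L[ℝ] E →L[ℝ] ℝ} {y : ℝ → E} {t : ℝ}
    (hy : ContDiffAt ℝ 2 y t) (hacc : coordAccel G y t = 0) :
    HasDerivAt (fun s ↦ (y s, deriv y s)) (geodesicField G (y t, deriv y t)) t := by
  have hsnd := hasDerivAt_deriv hy
  rw [eq_neg_of_add_eq_zero_left hacc] at hsnd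
  exact (hy.differentiableAt (by simp)).hasDerivAt.prodMk hsnd

theorem deriv_fst_of_hasDerivAt_geodesicField {G : E → E →L[ℝ] E →L[ℝ] ℝ} {α : ℝ → E × E} {t : ℝ}
    (hα : HasDerivAt α (geodesicField G (α t)) t) : deriv (fun s ↦ (α s).1) t = (α t).2 :=
  (show HasDerivAt (fun s ↦ (α s).1) _ t from hα.fst).deriv

theorem coordAccel_fst_eq_zero {G : E → E →L[ℝ] E →L[ℝ] ℝ} {α : ℝ → E × E} {t : ℝ}
    (hα : ∀ᶠ s in 𝓝 t, HasDerivAt α (geodesicField G (α s)) s) :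
    coordAccel G (fun s ↦ (α s).1) t = 0 := by
  have hfst : deriv (fun s ↦ (α s).1) =ᶠ[𝓝 t] fun s ↦ (α s).2 :=
    hα.mono fun s ↦ deriv_fst_of_hasDerivAt_geodesicField
  have hsnd : deriv (fun s ↦ (α s).2) t = -christoffel G (α t).1 (α t).2 (α t).2 :=
    (show HasDerivAt (fun s ↦ (α s).2) _ t from hα.self_of_nhds.snd).deriv
  rw [coordAccel, hfst.deriv_eq, hfst.self_of_nhds, hsnd, neg_add_cancel]

namespace IsMetricOn

variable [FiniteDimensional ℝ E] {G : E → E →L[ℝ] E →L[ℝ] ℝ} {U : Set E}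

theorem contDiffOn_geodesicField (h : IsMetricOn G U) :
    ContDiffOn ℝ ∞ (geodesicField G) (U ×ˢ Set.univ) := by
  have hΓ : ContDiffOn ℝ ∞ (fun q : E × E ↦ christoffel G q.1) (U ×ˢ Set.univ) :=
    h.contDiffOn_christoffel.comp contDiffOn_fst fun q hq ↦ hq.1
  exact contDiffOn_snd.prodMk ((hΓ.clm_apply contDiffOn_snd).clm_apply contDiffOn_snd).neg

theorem contDiffAt_geodesicField (h : IsMetricOn G U) {q : E × E} (hq : q.1 ∈ U) :
    ContDiffAt ℝ ∞ (geodesicField G) q :=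
  h.contDiffOn_geodesicField.contDiffAt ((h.isOpen.prod isOpen_univ).mem_nhds ⟨hq, trivial⟩)

theorem hasDerivAt_speed (h : IsMetricOn G U) {y : ℝ → E} {t : ℝ} (hyU : y t ∈ U)
    (hy : ContDiffAt ℝ 2 y t) (hacc : coordAccel G y t = 0) :
    HasDerivAt (fun s ↦ G (y s) (deriv y s) (deriv y s)) 0 t := by
  have hfst : HasDerivAt y (deriv y t) t := (hy.differentiableAt (by simp)).hasDerivAt
  have hsnd := hasDerivAt_deriv hy
  rw [eq_neg_of_add_eq_zero_left hacc] at hsnd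
  have hG : HasDerivAt (fun s ↦ G (y s)) (fderiv ℝ G (y t) (deriv y t)) t :=
    (h.differentiableAt hyU).hasFDerivAt.comp_hasDerivAt t hfst
  refine ((hG.clm_apply hsnd).clm_apply hsnd).congr_deriv ?_
  rw [map_neg, map_neg, h.symm _ hyU (deriv y t), add_apply, neg_apply, h.apply_christoffel hyU]
  ring

theorem exists_coordAccel_eq_zero (h : IsMetricOn G U) {x : E} (hx : x ∈ U) (v : E) :
    ∃ (y : ℝ → E) (ε : ℝ), 0 < ε ∧ y 0 = x ∧ deriv y 0 = v ∧ ∀ t ∈ Set.Ioo (-ε) ε,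
      y t ∈ U ∧ ContDiffAt ℝ ∞ y t ∧ coordAccel G y t = 0 := by
  have := FiniteDimensional.complete ℝ E
  obtain ⟨α, hα0, ε, hε, hα⟩ := ((h.contDiffAt_geodesicField (q := (x, v)) hx).of_le (m := 1)
    (by norm_cast)).exists_forall_mem_closedBall_exists_eq_forall_mem_Ioo_hasDerivAt₀ 0
  simp only [zero_sub, zero_add] at hα
  have hcont : ContinuousAt α 0 := (hα 0 ⟨neg_lt_zero.2 hε, hε⟩).continuousAt
  obtain ⟨δ, hδ, hball⟩ := Metric.eventually_nhds_iff.1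
    (hcont.fst.eventually (h.eventually_mem (by simpa only [hα0] using hx)))
  have hr : 0 < min ε δ := lt_min hε hδ
  have hode : ∀ t ∈ Set.Ioo (-min ε δ) (min ε δ), HasDerivAt α (geodesicField G (α t)) t :=
    fun t ht ↦ hα t ⟨(neg_le_neg (min_le_left _ _)).trans_lt ht.1,
      ht.2.trans_le (min_le_left _ _)⟩
  have hmem : ∀ t ∈ Set.Ioo (-min ε δ) (min ε δ), (α t).1 ∈ U := fun t ht ↦ by
    refine hball ?_
    rw [Real.dist_eq, sub_zero]
    exact (abs_lt.2 ht).trans_le (min_le_right _ _)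
  have hsmooth := contDiffOn_of_hasDerivAt_autonomous h.contDiffOn_geodesicField isOpen_Ioo hode
    fun t ht ↦ ⟨hmem t ht, trivial⟩
  refine ⟨fun t ↦ (α t).1, min ε δ, hr, congrArg Prod.fst hα0, ?_, fun t ht ↦ ⟨hmem t ht, ?_, ?_⟩⟩
  · rw [deriv_fst_of_hasDerivAt_geodesicField (hode 0 ⟨neg_lt_zero.2 hr, hr⟩), hα0]
  · exact (hsmooth.contDiffAt (Ioo_mem_nhds ht.1 ht.2)).fst
  · exact coordAccel_fst_eq_zero (eventually_of_mem (Ioo_mem_nhds ht.1 ht.2) hode)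

end IsMetricOn

end GeodesicField

section LocalGeodesics

variable {E : Type*} [NormedAddCommGroup E] [NormedSpace ℝ E] [FiniteDimensional ℝ E]
  {M : Type*} [TopologicalSpace M] [ChartedSpace E M] [IsManifold 𝓘(ℝ, E) ∞ M]
  [RiemannianBundle (fun x : M ↦ TangentSpace 𝓘(ℝ, E) x)]
  [IsContMDiffRiemannianBundle 𝓘(ℝ, E) ∞ E (fun x : M ↦ TangentSpace 𝓘(ℝ, E) x)]

theorem IsGeodesicAt.hasDerivAt_phase {γ : ℝ → M} {t : ℝ} {c : M}
    (h : IsGeodesicAt E γ t) (hc : γ t ∈ (extChartAt 𝓘(ℝ, E) c).source) :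
    HasDerivAt (fun s ↦ ((extChartAt 𝓘(ℝ, E) c ∘ γ) s, deriv (extChartAt 𝓘(ℝ, E) c ∘ γ) s))
      (geodesicField (chartMetric c) ((extChartAt 𝓘(ℝ, E) c ∘ γ) t,
        deriv (extChartAt 𝓘(ℝ, E) c ∘ γ) t)) t :=
  RiemGeom.hasDerivAt_phase
    ((contDiffAt_extChartAt_comp le_rfl h.contMDiffAt hc).of_le (by norm_cast))
    ((isGeodesicAt_iff hc).1 h).2

theorem eventuallyEq_of_isGeodesicAt {γ₁ γ₂ : ℝ → M} {t : ℝ} {c : M}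
    (h₁ : ∀ᶠ s in 𝓝 t, IsGeodesicAt E γ₁ s) (h₂ : ∀ᶠ s in 𝓝 t, IsGeodesicAt E γ₂ s)
    (hc : γ₁ t ∈ (extChartAt 𝓘(ℝ, E) c).source) (heq : γ₁ t = γ₂ t)
    (hderiv : deriv (extChartAt 𝓘(ℝ, E) c ∘ γ₁) t = deriv (extChartAt 𝓘(ℝ, E) c ∘ γ₂) t) :
    γ₁ =ᶠ[𝓝 t] γ₂ := by
  have hphase : ((extChartAt 𝓘(ℝ, E) c ∘ γ₁) t, deriv (extChartAt 𝓘(ℝ, E) c ∘ γ₁) t) =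
      ((extChartAt 𝓘(ℝ, E) c ∘ γ₂) t, deriv (extChartAt 𝓘(ℝ, E) c ∘ γ₂) t) := by
    rw [hderiv, Function.comp_apply, Function.comp_apply, heq]
  obtain ⟨K, S, hS, hK⟩ := (((isMetricOn_chartMetric c).contDiffAt_geodesicField
    (q := ((extChartAt 𝓘(ℝ, E) c ∘ γ₁) t, deriv (extChartAt 𝓘(ℝ, E) c ∘ γ₁) t))
    ((extChartAt 𝓘(ℝ, E) c).map_source hc)).of_le (m := 1) (by norm_cast)).exists_lipschitzOnWith
  have hsrc {γ : ℝ → M} (h : IsGeodesicAt E γ t) (hγ : γ t = γ₁ t) :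
      ∀ᶠ s in 𝓝 t, γ s ∈ (extChartAt 𝓘(ℝ, E) c).source :=
    h.contMDiffAt.continuousAt.eventually (extChartAt_source_mem_nhds' (hγ ▸ hc))
  have hode {γ : ℝ → M} (h : ∀ᶠ s in 𝓝 t, IsGeodesicAt E γ s) (hγ : γ t = γ₁ t)
      (hSγ : S ∈ 𝓝 ((extChartAt 𝓘(ℝ, E) c ∘ γ) t, deriv (extChartAt 𝓘(ℝ, E) c ∘ γ) t)) :
      ∀ᶠ s in 𝓝 t, HasDerivAt
        (fun s ↦ ((extChartAt 𝓘(ℝ, E) c ∘ γ) s, deriv (extChartAt 𝓘(ℝ, E) c ∘ γ) s))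
        (geodesicField (chartMetric c)
          ((extChartAt 𝓘(ℝ, E) c ∘ γ) s, deriv (extChartAt 𝓘(ℝ, E) c ∘ γ) s)) s ∧
        ((extChartAt 𝓘(ℝ, E) c ∘ γ) s, deriv (extChartAt 𝓘(ℝ, E) c ∘ γ) s) ∈ S := by
    have hcont := (h.self_of_nhds.hasDerivAt_phase (c := c) (hγ ▸ hc)).continuousAt
    filter_upwards [h, hsrc h.self_of_nhds hγ, hcont.eventually hSγ] with s hs hs' hsS
    exact ⟨hs.hasDerivAt_phase hs', hsS⟩
  have huniq := ODE_solution_unique_of_eventually (v := fun _ ↦ geodesicField (chartMetric c))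
    (s := fun _ ↦ S) (t₀ := t) (Eventually.of_forall fun _ ↦ hK) (hode h₁ rfl hS)
    (hode h₂ heq.symm (hphase ▸ hS)) hphase
  filter_upwards [huniq, hsrc h₁.self_of_nhds rfl, hsrc h₂.self_of_nhds heq.symm]
    with s hs hs₁ hs₂
  exact (extChartAt 𝓘(ℝ, E) c).injOn hs₁ hs₂ (congrArg Prod.fst hs)

theorem eqOn_of_isGeodesicAt [T2Space M] {γ₁ γ₂ : ℝ → M} {S : Set ℝ} (hS : IsOpen S)
    (hS' : IsPreconnected S) (h₁ : ∀ s ∈ S, IsGeodesicAt E γ₁ s)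
    (h₂ : ∀ s ∈ S, IsGeodesicAt E γ₂ s) {t : ℝ} (ht : t ∈ S) (heq : γ₁ =ᶠ[𝓝 t] γ₂) :
    Set.EqOn γ₁ γ₂ S := by
  have hsub : S ⊆ {s | γ₁ =ᶠ[𝓝 s] γ₂} := by
    refine hS'.subset_of_closure_inter_subset
      (isOpen_iff_mem_nhds.2 fun s hs ↦ eventually_eventually_nhds.2 hs) ⟨t, ht, heq⟩ ?_
    rintro r ⟨hr, hrS⟩
    have hfreq : ∃ᶠ s in 𝓝 r, γ₁ =ᶠ[𝓝 s] γ₂ := mem_closure_iff_frequently.1 hr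
    have hval : γ₁ r = γ₂ r := tendsto_nhds_unique_of_frequently_eq
      (h₁ r hrS).contMDiffAt.continuousAt (h₂ r hrS).contMDiffAt.continuousAt
      (hfreq.mono fun s hs ↦ hs.self_of_nhds)
    have hsrc := mem_extChartAt_source (I := 𝓘(ℝ, E)) (γ₁ r)
    have hderiv : deriv (extChartAt 𝓘(ℝ, E) (γ₁ r) ∘ γ₁) r =
        deriv (extChartAt 𝓘(ℝ, E) (γ₁ r) ∘ γ₂) r :=
      tendsto_nhds_unique_of_frequently_eq ((h₁ r hrS).hasDerivAt_phase hsrc).continuousAt.snd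
        ((h₂ r hrS).hasDerivAt_phase (c := γ₁ r) (hval ▸ hsrc)).continuousAt.snd
        (hfreq.mono fun s hs ↦ (hs.fun_comp (extChartAt 𝓘(ℝ, E) (γ₁ r))).deriv_eq)
    exact eventuallyEq_of_isGeodesicAt (eventually_of_mem (hS.mem_nhds hrS) h₁)
      (eventually_of_mem (hS.mem_nhds hrS) h₂) hsrc hval hderiv
  exact fun s hs ↦ (hsub hs).self_of_nhds

theorem exists_isGeodesicAt (p : M) (v : E) : ∃ (γ : ℝ → M) (ε : ℝ), 0 < ε ∧ γ 0 = p ∧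
    deriv (extChartAt 𝓘(ℝ, E) p ∘ γ) 0 = v ∧ ∀ t ∈ Set.Ioo (-ε) ε, IsGeodesicAt E γ t := by
  have hp := mem_extChartAt_source (I := 𝓘(ℝ, E)) p
  obtain ⟨y, ε, hε, hy0, hv, hy⟩ :=
    (isMetricOn_chartMetric p).exists_coordAccel_eq_zero ((extChartAt 𝓘(ℝ, E) p).map_source hp) v
  have hcoord : ∀ t ∈ Set.Ioo (-ε) ε,
      extChartAt 𝓘(ℝ, E) p ∘ (extChartAt 𝓘(ℝ, E) p).symm ∘ y =ᶠ[𝓝 t] y := fun t ht ↦ by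
    filter_upwards [Ioo_mem_nhds ht.1 ht.2] with s hs
    exact (extChartAt 𝓘(ℝ, E) p).right_inv (hy s hs).1
  refine ⟨(extChartAt 𝓘(ℝ, E) p).symm ∘ y, ε, hε, ?_, ?_, fun t ht ↦ ?_⟩
  · rw [Function.comp_apply, hy0, (extChartAt 𝓘(ℝ, E) p).left_inv hp]
  · rw [(hcoord 0 ⟨neg_lt_zero.2 hε, hε⟩).deriv_eq, hv]
  · obtain ⟨hyt, hsmooth, haccel⟩ := hy t ht
    refine (isGeodesicAt_iff (c := p) ((extChartAt 𝓘(ℝ, E) p).map_target hyt)).2 ⟨?_, ?_⟩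
    · exact (contMDiffAt_extChartAt_symm hyt).comp t (contMDiffAt_iff_contDiffAt.2 hsmooth)
    · rw [coordAccel_congr (hcoord t ht), haccel]

end LocalGeodesics

section Geodesics

variable {E : Type*} [NormedAddCommGroup E] [NormedSpace ℝ E]
  {M : Type*} [MetricSpace M] [ChartedSpace E M] [IsManifold 𝓘(ℝ, E) ∞ M]
  [RiemannianBundle (fun x : M ↦ TangentSpace 𝓘(ℝ, E) x)] {γ : ℝ → M}

theorem isGeodesic_iff : IsGeodesic E γ ↔ ∀ t, IsGeodesicAt E γ t :=
  ⟨fun h t ↦ ⟨h.contMDiff t, (covDerivAlong_velocity_eq_zero_iff (h.contMDiff t)).1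
    (h.covDeriv_velocity t)⟩, fun h ↦ ⟨fun t ↦ (h t).contMDiffAt, fun t ↦
    (covDerivAlong_velocity_eq_zero_iff (h t).contMDiffAt).2 (h t).coordAccel_eq_zero⟩⟩

variable [FiniteDimensional ℝ E]
  [IsContMDiffRiemannianBundle 𝓘(ℝ, E) ∞ E (fun x : M ↦ TangentSpace 𝓘(ℝ, E) x)]

theorem IsGeodesic.norm_velocity_eq (h : IsGeodesic E γ) (s t : ℝ) :
    ‖velocity E γ s‖ = ‖velocity E γ t‖ := by
  have hzero : ∀ t,
      HasDerivAt (fun s ↦ (inner ℝ (velocity E γ s) (velocity E γ s) : ℝ)) 0 t := fun t ↦ by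
    have hgeod := isGeodesic_iff.1 h t
    have hsrc := mem_extChartAt_source (I := 𝓘(ℝ, E)) (γ t)
    have hspeed := (isMetricOn_chartMetric (γ t)).hasDerivAt_speed
      (y := extChartAt 𝓘(ℝ, E) (γ t) ∘ γ) ((extChartAt 𝓘(ℝ, E) (γ t)).map_source hsrc)
      ((contDiffAt_extChartAt_comp le_rfl hgeod.contMDiffAt hsrc).of_le (by norm_cast))
      hgeod.coordAccel_eq_zero
    refine hspeed.congr_of_eventuallyEq ?_
    filter_upwards [hgeod.contMDiffAt.continuousAt.eventually
      (extChartAt_source_mem_nhds (I := 𝓘(ℝ, E)) (γ t))] with s hs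
    rw [← coord_velocity ((h.contMDiff s).mdifferentiableAt (by simp)) hs]
    exact (chartMetric_coord hs _ _).symm
  have hconst := is_const_of_deriv_eq_zero (fun t ↦ (hzero t).differentiableAt)
    (fun t ↦ (hzero t).deriv) s t
  rw [@norm_eq_sqrt_real_inner (TangentSpace 𝓘(ℝ, E) (γ s)),
    @norm_eq_sqrt_real_inner (TangentSpace 𝓘(ℝ, E) (γ t)), hconst]

end Geodesics

/-! ### Symmetric spaces -/

section Symmetries

variable {E : Type*} [NormedAddCommGroup E] [NormedSpace ℝ E]
  {M : Type*} [TopologicalSpace M] [ChartedSpace E M]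
  [RiemannianBundle (fun x : M ↦ TangentSpace 𝓘(ℝ, E) x)]

theorem IsRiemannianIsometry.symm {s : M ≃ₘ^∞⟮𝓘(ℝ, E), 𝓘(ℝ, E)⟯ M}
    (hs : IsRiemannianIsometry E s) : IsRiemannianIsometry E s.symm where
  contMDiff := s.symm.contMDiff
  inner_mfderiv x u w := by
    obtain ⟨z, rfl⟩ := s.surjective x
    have hsurj : Function.Surjective (mfderiv 𝓘(ℝ, E) 𝓘(ℝ, E) s z) :=
      (s.mfderivToContinuousLinearEquiv (by simp) z).surjective
    obtain ⟨u, rfl⟩ := hsurj u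
    obtain ⟨w, rfl⟩ := hsurj w
    have hid : IsRiemannianIsometry E (s.symm ∘ s : M → M) := by
      rw [show (s.symm ∘ s : M → M) = fun x ↦ x from funext s.symm_apply_apply]
      exact .id
    have hcomp := hid.inner_mfderiv z u w
    rw [mfderiv_comp z ((s.symm.contMDiff _).mdifferentiableAt (by simp))
      ((s.contMDiff _).mdifferentiableAt (by simp))] at hcomp
    exact hcomp.trans (hs.inner_mfderiv z u w).symm

variable (E M) in
/-- The group of isometries of a Riemannian manifold. -/
def isometryGroup : Subgroup (Equiv.Perm M) where
  carrier := {e | IsRiemannianIsometry E e ∧ IsRiemannianIsometry E e.symm}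
  one_mem' := ⟨.id, .id⟩
  mul_mem' ha hb := ⟨ha.1.comp hb.1, hb.2.comp ha.2⟩
  inv_mem' ha := ⟨ha.2, ha.1⟩

variable (E) in
/-- `s` is the geodesic symmetry at `p`. The equation in the tangent bundle encodes both `s p = p`
and `ds_p = -id`. -/
structure IsSymmetryAt (p : M) (s : Equiv.Perm M) : Prop where
  mem : s ∈ isometryGroup E M
  tangentMap_eq : ∀ u : TangentSpace 𝓘(ℝ, E) p,
    tangentMap 𝓘(ℝ, E) 𝓘(ℝ, E) s ⟨p, u⟩ = (⟨p, -u⟩ : TangentBundle 𝓘(ℝ, E) M)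

namespace IsSymmetryAt

variable {p : M} {s : Equiv.Perm M}

theorem isRiemannianIsometry (h : IsSymmetryAt E p s) : IsRiemannianIsometry E s := h.mem.1

theorem apply_self (h : IsSymmetryAt E p s) : s p = p :=
  congrArg TotalSpace.proj (h.tangentMap_eq 0)

theorem coord_mfderiv (h : IsSymmetryAt E p s) (c : M) (u : TangentSpace 𝓘(ℝ, E) p) :
    coord c (s p) (mfderiv 𝓘(ℝ, E) 𝓘(ℝ, E) s p u) = -coord c p u :=
  (congrArg (fun X : TangentBundle 𝓘(ℝ, E) M ↦ coord c X.proj X.snd) (h.tangentMap_eq u)).trans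
    (map_neg (coord c p) u)

variable [IsManifold 𝓘(ℝ, E) ∞ M] {γ : ℝ → M} {a : ℝ}

theorem deriv_extChartAt_comp (h : IsSymmetryAt E (γ a) s)
    (hγ : MDifferentiableAt 𝓘(ℝ, ℝ) 𝓘(ℝ, E) γ a) :
    deriv (extChartAt 𝓘(ℝ, E) (γ a) ∘ s ∘ γ) a = -deriv (extChartAt 𝓘(ℝ, E) (γ a) ∘ γ) a := by
  have hs := (h.isRiemannianIsometry.contMDiff (γ a)).mdifferentiableAt (n := ∞) (by simp)
  have hsrc := mem_extChartAt_source (I := 𝓘(ℝ, E)) (γ a)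
  have hsrc' : (s ∘ γ) a ∈ (extChartAt 𝓘(ℝ, E) (γ a)).source := h.apply_self.symm ▸ hsrc
  rw [← coord_velocity (hs.comp a hγ) hsrc', ← coord_velocity hγ hsrc,
    ← h.coord_mfderiv (γ a) (velocity E γ a)]
  exact congrArg (fun L ↦ coord (γ a) (s (γ a)) (L (1 : ℝ))) (mfderiv_comp a hs hγ)

variable [T2Space M] [FiniteDimensional ℝ E]
  [IsContMDiffRiemannianBundle 𝓘(ℝ, E) ∞ E (fun x : M ↦ TangentSpace 𝓘(ℝ, E) x)]

theorem apply_geodesic (h : IsSymmetryAt E (γ a) s) {S : Set ℝ} (hS : IsOpen S)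
    (hS' : IsPreconnected S) (hγ : ∀ t ∈ S, IsGeodesicAt E γ t)
    (hrefl : ∀ t ∈ S, -t + 2 * a ∈ S) (ha : a ∈ S) : ∀ t ∈ S, s (γ t) = γ (-t + 2 * a) := by
  have hcomp : ∀ t ∈ S, IsGeodesicAt E (s ∘ γ) t :=
    fun t ht ↦ (hγ t ht).comp_isometry h.isRiemannianIsometry
  have hreverse : ∀ t ∈ S, IsGeodesicAt E (fun t ↦ γ (-t + 2 * a)) t :=
    fun t ht ↦ (hγ _ (hrefl t ht)).comp_add.comp_neg
  have hcentre : -a + 2 * a = a := by ring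
  refine eqOn_of_isGeodesicAt hS hS' hcomp hreverse ha (eventuallyEq_of_isGeodesicAt (c := γ a)
    (eventually_of_mem (hS.mem_nhds ha) hcomp) (eventually_of_mem (hS.mem_nhds ha) hreverse)
    (h.apply_self.symm ▸ mem_extChartAt_source (γ a)) (by simp [h.apply_self, hcentre]) ?_)
  have hderiv := deriv_comp_neg (fun t ↦ (extChartAt 𝓘(ℝ, E) (γ a) ∘ γ) (t + 2 * a)) a
  rw [deriv_comp_add_const, hcentre] at hderiv
  exact (h.deriv_extChartAt_comp ((hγ a ha).contMDiffAt.mdifferentiableAt (by simp))).trans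
    hderiv.symm

end IsSymmetryAt

end Symmetries

section EquivariantExtension

variable {X : Type*}

/-- The `T`-equivariant extension of the piece `c : [0, a) → X` of a curve to the real line: on
`[n * a, (n + 1) * a)` it is the image under `T ^ n` of the piece. -/
noncomputable def equivariantExtension (T : Equiv.Perm X) (c : ℝ → X) (a t : ℝ) : X :=
  (T ^ ⌊t / a⌋) (c (t - ⌊t / a⌋ * a))

variable {T : Equiv.Perm X} {c : ℝ → X} {a : ℝ}

theorem apply_equivariantExtension (ha : a ≠ 0) (t : ℝ) :
    T (equivariantExtension T c a t) = equivariantExtension T c a (t + a) := by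
  have hfloor : ⌊(t + a) / a⌋ = ⌊t / a⌋ + 1 := by
    rw [add_div, div_self ha, Int.floor_add_one]
  rw [equivariantExtension, equivariantExtension, hfloor, ← Equiv.Perm.mul_apply, ← zpow_one_add,
    add_comm 1]
  congr 2
  push_cast
  ring

theorem equivariantExtension_eq (hT : ∀ t ∈ Set.Ioo (-a) 0, T (c t) = c (t + a)) {t : ℝ} {n : ℤ}
    (ht : |t - n * a| < a) : equivariantExtension T c a t = (T ^ n) (c (t - n * a)) := by
  have ha : 0 < a := (abs_nonneg _).trans_lt ht
  rw [abs_lt] at ht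
  rcases le_or_gt (n * a) t with hle | hlt
  · have hfloor : ⌊t / a⌋ = n := by
      rw [Int.floor_eq_iff, le_div_iff₀ ha, div_lt_iff₀ ha]
      exact ⟨hle, by linarith⟩
    rw [equivariantExtension, hfloor]
  · have hfloor : ⌊t / a⌋ = n - 1 := by
      rw [Int.floor_eq_iff, le_div_iff₀ ha, div_lt_iff₀ ha]
      push_cast
      exact ⟨by linarith, by linarith⟩
    have hshift : t - ((n - 1 : ℤ) : ℝ) * a = t - n * a + a := by
      push_cast
      ring
    rw [equivariantExtension, hfloor, hshift, ← hT _ ⟨ht.1, by linarith⟩, ← Equiv.Perm.mul_apply,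
      ← zpow_add_one, sub_add_cancel]

theorem equivariantExtension_eventuallyEq (hT : ∀ t ∈ Set.Ioo (-a) 0, T (c t) = c (t + a)) {t : ℝ}
    {n : ℤ} (ht : |t - n * a| < a) :
    equivariantExtension T c a =ᶠ[𝓝 t] (T ^ n) ∘ fun r ↦ c (r + -(n * a)) := by
  have hcont : Continuous fun r : ℝ ↦ |r - n * a| := by fun_prop
  filter_upwards [hcont.continuousAt.eventually (Iio_mem_nhds ht)] with r hr
  exact equivariantExtension_eq hT hr

end EquivariantExtension

section GlobalGeodesics

variable {E : Type*} [NormedAddCommGroup E] [NormedSpace ℝ E]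
  {M : Type*} [MetricSpace M] [ChartedSpace E M]
  [RiemannianBundle (fun x : M ↦ TangentSpace 𝓘(ℝ, E) x)]

theorem IsSymmetricSpace.exists_isSymmetryAt (h : IsSymmetricSpace E M) (p : M) :
    ∃ s, IsSymmetryAt E p s := by
  obtain ⟨s, hs, hp⟩ := h p
  have hiso : IsRiemannianIsometry E (s : M → M) := ⟨s.contMDiff, hs⟩
  exact ⟨s.toEquiv, ⟨hiso, hiso.symm⟩, hp⟩

variable [FiniteDimensional ℝ E] [IsManifold 𝓘(ℝ, E) ∞ M]
  [IsContMDiffRiemannianBundle 𝓘(ℝ, E) ∞ E (fun x : M ↦ TangentSpace 𝓘(ℝ, E) x)]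

theorem IsSymmetryAt.apply_isGeodesic {γ : ℝ → M} (hγ : IsGeodesic E γ) {a : ℝ}
    {s : Equiv.Perm M} (hs : IsSymmetryAt E (γ a) s) (t : ℝ) : s (γ t) = γ (-t + 2 * a) :=
  hs.apply_geodesic isOpen_univ isPreconnected_univ (fun t _ ↦ isGeodesic_iff.1 hγ t)
    (fun _ _ ↦ trivial) trivial t trivial

-- The product of the symmetries at `c 0` and `c (a / 2)` is a transvection.
theorem IsSymmetricSpace.exists_translation (h : IsSymmetricSpace E M) {c : ℝ → M} {a : ℝ}
    (hc : ∀ t ∈ Set.Ioo (-(2 * a)) (2 * a), IsGeodesicAt E c t) :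
    ∃ T ∈ isometryGroup E M, ∀ t ∈ Set.Ioo (-a) 0, T (c t) = c (t + a) := by
  obtain ⟨s₀, hs₀⟩ := h.exists_isSymmetryAt (c 0)
  obtain ⟨s₁, hs₁⟩ := h.exists_isSymmetryAt (c (a / 2))
  refine ⟨s₁ * s₀, mul_mem hs₁.mem hs₀.mem, fun t ⟨hat, ht0⟩ ↦ ?_⟩
  have hrefl₀ : s₀ (c t) = c (-t) := by
    have hrefl := hs₀.apply_geodesic isOpen_Ioo isPreconnected_Ioo hc
      (fun r hr ↦ ⟨by linarith [hr.2], by linarith [hr.1]⟩) ⟨by linarith, by linarith⟩ t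
      ⟨by linarith, by linarith⟩
    rwa [mul_zero, add_zero] at hrefl
  have hrefl₁ : s₁ (c (-t)) = c (t + a) := by
    have hrefl := hs₁.apply_geodesic (S := Set.Ioo (-a) (2 * a)) isOpen_Ioo isPreconnected_Ioo
      (fun r hr ↦ hc r ⟨by linarith [hr.1], hr.2⟩)
      (fun r hr ↦ ⟨by linarith [hr.2], by linarith [hr.1]⟩) ⟨by linarith, by linarith⟩ (-t)
      ⟨by linarith, by linarith⟩
    rwa [neg_neg, mul_div_cancel₀ a two_ne_zero] at hrefl
  rw [Equiv.Perm.mul_apply, hrefl₀, hrefl₁]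

theorem isGeodesic_equivariantExtension {T : Equiv.Perm M} (hTmem : T ∈ isometryGroup E M)
    {c : ℝ → M} {a : ℝ} (ha : 0 < a) (hc : ∀ t ∈ Set.Ioo (-a) a, IsGeodesicAt E c t)
    (hT : ∀ t ∈ Set.Ioo (-a) 0, T (c t) = c (t + a)) :
    IsGeodesic E (equivariantExtension T c a) := by
  refine isGeodesic_iff.2 fun t ↦ ?_
  have hnear : |t - ⌊t / a⌋ * a| < a := by
    rw [abs_of_nonneg (Int.sub_floor_div_mul_nonneg t ha)]
    exact Int.sub_floor_div_mul_lt t ha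
  refine IsGeodesicAt.congr ?_ (equivariantExtension_eventuallyEq hT hnear)
  exact (IsGeodesicAt.comp_add (hc _ (abs_lt.1 hnear))).comp_isometry
    (zpow_mem hTmem ⌊t / a⌋ : T ^ ⌊t / a⌋ ∈ isometryGroup E M).1

theorem IsSymmetricSpace.exists_isGeodesic (h : IsSymmetricSpace E M) (p : M) (v : E) :
    ∃ γ : ℝ → M, IsGeodesic E γ ∧ γ 0 = p ∧ deriv (extChartAt 𝓘(ℝ, E) p ∘ γ) 0 = v ∧
      ∃ T ∈ isometryGroup E M, ∃ a > 0, ∀ t, T (γ t) = γ (t + a) := by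
  obtain ⟨c, ε, hε, hc0, hcv, hc⟩ := exists_isGeodesicAt p v
  have ha : 0 < ε / 2 := half_pos hε
  obtain ⟨T, hTmem, hT⟩ :=
    h.exists_translation (a := ε / 2) (by rwa [mul_div_cancel₀ ε two_ne_zero])
  have hgerm : equivariantExtension T c (ε / 2) =ᶠ[𝓝 0] c := by
    simpa using equivariantExtension_eventuallyEq hT (t := 0) (n := 0) (by simpa using hε)
  refine ⟨equivariantExtension T c (ε / 2),
    isGeodesic_equivariantExtension hTmem ha (fun t ht ↦ hc t ⟨?_, ?_⟩) hT,
    hgerm.self_of_nhds.trans hc0, (hgerm.fun_comp _).deriv_eq.trans hcv, T, hTmem, ε / 2, ha,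
    apply_equivariantExtension ha.ne'⟩
  · linarith [ht.1]
  · linarith [ht.2]

theorem IsSymmetricSpace.exists_isUnitSpeedGeodesic (h : IsSymmetricSpace E M) (p : M)
    (v : TangentSpace 𝓘(ℝ, E) p) (hv : ‖v‖ = 1) :
    ∃ γ : ℝ → M, IsUnitSpeedGeodesic E γ ∧
      (⟨γ 0, velocity E γ 0⟩ : TangentBundle 𝓘(ℝ, E) M) = ⟨p, v⟩ ∧
      ∃ T ∈ isometryGroup E M, ∃ a > 0, ∀ t, T (γ t) = γ (t + a) := by
  obtain ⟨γ, hγ, rfl, hderiv, hT⟩ := h.exists_isGeodesic p (coord p p v)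
  have hsrc := mem_extChartAt_source (I := 𝓘(ℝ, E)) (γ 0)
  rw [← coord_velocity ((hγ.contMDiff 0).mdifferentiableAt (by simp)) hsrc] at hderiv
  obtain rfl := (isInvertible_coord (E := E) hsrc).injective hderiv
  exact ⟨γ, ⟨hγ, fun t ↦ (hγ.norm_velocity_eq t 0).trans hv⟩, rfl, hT⟩

end GlobalGeodesics

section Distance

open Manifold

variable {E : Type*} [NormedAddCommGroup E] [NormedSpace ℝ E]
  {M : Type*} [MetricSpace M] [ChartedSpace E M]
  [RiemannianBundle (fun x : M ↦ TangentSpace 𝓘(ℝ, E) x)] [IsRiemannianManifold 𝓘(ℝ, E) M]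

theorem IsRiemannianIsometry.edist_le {s : M → M}
    (hs : IsRiemannianIsometry E s) (x y : M) : edist (s x) (s y) ≤ edist x y := by
  rw [IsRiemannianManifold.out (I := 𝓘(ℝ, E)) (s x), IsRiemannianManifold.out (I := 𝓘(ℝ, E)) x]
  refine le_of_forall_gt fun r hr ↦ ?_
  obtain ⟨γ, hγ0, hγ1, hγ, hlen, -⟩ :=
    exists_lt_locally_constant_of_riemannianEDist_lt hr zero_lt_one
  have hpath : riemannianEDist 𝓘(ℝ, E) (s x) (s y) ≤ pathELength 𝓘(ℝ, E) (s ∘ γ) 0 1 :=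
    riemannianEDist_le_pathELength ((hs.contMDiff.of_le (by norm_cast)).comp hγ).contMDiffOn
      (by simp [hγ0]) (by simp [hγ1]) zero_le_one
  refine (hpath.trans_eq ?_).trans_lt hlen
  rw [pathELength_eq_lintegral_mfderiv_Icc, pathELength_eq_lintegral_mfderiv_Icc]
  refine MeasureTheory.lintegral_congr fun t ↦ ?_
  rw [mfderiv_comp t ((hs.contMDiff _).mdifferentiableAt (by simp))
    ((hγ t).mdifferentiableAt (by simp))]
  exact (enorm_norm (E := TangentSpace 𝓘(ℝ, E) (s (γ t))) _).symm.trans ((congrArg enorm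
    (hs.norm_mfderiv (γ t) (mfderiv 𝓘(ℝ, ℝ) 𝓘(ℝ, E) γ t (1 : ℝ)))).trans (enorm_norm _))

theorem dist_apply_of_mem_isometryGroup {s : Equiv.Perm M}
    (hs : s ∈ isometryGroup E M) (x y : M) : dist (s x) (s y) = dist x y := by
  have hle := hs.1.edist_le x y
  have hge := hs.2.edist_le (s x) (s y)
  rw [s.symm_apply_apply, s.symm_apply_apply] at hge
  rw [dist_edist, dist_edist, le_antisymm hle hge]

theorem IsUnitSpeedGeodesic.dist_le {γ : ℝ → M}
    (h : IsUnitSpeedGeodesic E γ) (s t : ℝ) : dist (γ s) (γ t) ≤ |s - t| := by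
  wlog hst : s ≤ t generalizing s t
  · rw [dist_comm, abs_sub_comm]
    exact this t s (le_of_not_ge hst)
  have hspeed (r : ℝ) : ‖mfderiv 𝓘(ℝ, ℝ) 𝓘(ℝ, E) γ r (1 : ℝ)‖ₑ = 1 :=
    (enorm_norm (velocity E γ r)).symm.trans (by rw [h.norm_velocity r, enorm_one])
  have hedist : edist (γ s) (γ t) ≤ ENNReal.ofReal (t - s) := by
    rw [IsRiemannianManifold.out (I := 𝓘(ℝ, E)) (γ s)]
    refine (riemannianEDist_le_pathELength (γ := γ)
      (h.contMDiff.of_le (by norm_cast)).contMDiffOn rfl rfl hst).trans_eq ?_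
    rw [pathELength_eq_lintegral_mfderiv_Icc]
    exact (MeasureTheory.lintegral_congr hspeed).trans (by simp)
  rw [dist_edist, abs_sub_comm, abs_of_nonneg (sub_nonneg.2 hst)]
  exact ENNReal.toReal_le_of_le_ofReal (sub_nonneg.2 hst) hedist

end Distance

/-! ### Busemann functions -/

section Busemann

variable {M : Type*} [MetricSpace M] {γ : ℝ → M}

theorem dist_add_natCast_mul {a : ℝ}
    (htrans : ∀ s t, dist (γ (s + a)) (γ (t + a)) = dist (γ s) (γ t)) (n : ℕ) (s t : ℝ) :
    dist (γ (s + n * a)) (γ (t + n * a)) = dist (γ s) (γ t) := by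
  induction n with
  | zero => simp
  | succ n ih =>
    have hstep := htrans (s + n * a) (t + n * a)
    rw [add_assoc, add_assoc, ← add_one_mul] at hstep
    rw [Nat.cast_succ, hstep, ih]

namespace IsBusemannFunction

variable {b : M → ℝ}

theorem sub_le_dist (hb : IsBusemannFunction γ b) (x y : M) : b x - b y ≤ dist x y := by
  refine le_of_tendsto ((hb x).sub (hb y)) (Eventually.of_forall fun t ↦ ?_)
  linarith [dist_triangle x y (γ t)]

theorem abs_sub_le_dist (hb : IsBusemannFunction γ b) (x y : M) : |b x - b y| ≤ dist x y :=
  abs_sub_le_iff.2 ⟨hb.sub_le_dist x y, dist_comm y x ▸ hb.sub_le_dist y x⟩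

theorem unique {b' : M → ℝ} (hb : IsBusemannFunction γ b) (hb' : IsBusemannFunction γ b') :
    b = b' :=
  funext fun x ↦ tendsto_nhds_unique (hb x) (hb' x)

theorem tendsto_dist_atTop (hb : IsBusemannFunction γ b) (x : M) :
    Tendsto (fun t ↦ dist x (γ t)) atTop atTop :=
  ((hb x).add_atTop tendsto_id).congr fun t ↦ sub_add_cancel (dist x (γ t)) t

-- If `γ` lost `η > 0` of length in each period, then `dist (γ s) (γ t) - t` would tend to `-∞`.
theorem le_dist_of_periodic (hb : IsBusemannFunction γ b) {L s : ℝ} (hL : 0 < L)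
    (hper : ∀ m : ℕ, dist (γ (s + m * L)) (γ (s + L + m * L)) = dist (γ s) (γ (s + L))) :
    L ≤ dist (γ s) (γ (s + L)) := by
  by_contra! hlt
  have hchain (m : ℕ) : dist (γ s) (γ (s + m * L)) ≤ m * dist (γ s) (γ (s + L)) := by
    have hpoly := dist_le_range_sum_dist (fun i : ℕ ↦ γ (s + i * L)) m
    have hstep (i : ℕ) : dist (γ (s + i * L)) (γ (s + (i + 1 : ℕ) * L)) =
        dist (γ s) (γ (s + L)) := by
      rw [← hper i, Nat.cast_succ, add_one_mul, add_comm _ L, add_assoc]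
    simp only [hstep, Finset.sum_const, Finset.card_range, nsmul_eq_mul, Nat.cast_zero, zero_mul,
      add_zero] at hpoly
    exact hpoly
  have htop : Tendsto (fun m : ℕ ↦ s + m * L) atTop atTop :=
    tendsto_atTop_add_const_left _ _ (tendsto_natCast_atTop_atTop.atTop_mul_const hL)
  have hbot : Tendsto (fun m : ℕ ↦ -s - m * (L - dist (γ s) (γ (s + L)))) atTop atBot :=
    tendsto_atBot_add_const_left _ _ (tendsto_neg_atTop_atBot.comp
      (tendsto_natCast_atTop_atTop.atTop_mul_const (sub_pos.2 hlt)))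
  refine not_tendsto_nhds_of_tendsto_atBot (tendsto_atBot_mono (fun m ↦ ?_) hbot) _
    ((hb (γ s)).comp htop)
  simp only [Function.comp_apply]
  linarith [hchain m]

theorem dist_eq (hb : IsBusemannFunction γ b) (hlip : ∀ s t, dist (γ s) (γ t) ≤ |s - t|) {a : ℝ}
    (ha : 0 < a) (htrans : ∀ s t, dist (γ (s + a)) (γ (t + a)) = dist (γ s) (γ t)) (s t : ℝ) :
    dist (γ s) (γ t) = |s - t| := by
  wlog hst : s ≤ t generalizing s t
  · rw [dist_comm, abs_sub_comm]
    exact this t s (le_of_not_ge hst)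
  refine le_antisymm (hlip s t) ?_
  obtain ⟨N, hN⟩ := exists_nat_gt ((t - s) / a)
  rw [div_lt_iff₀ ha] at hN
  have hper (m : ℕ) : dist (γ (s + m * (N * a))) (γ (s + N * a + m * (N * a))) =
      dist (γ s) (γ (s + N * a)) := by
    have hshift := dist_add_natCast_mul htrans (m * N) s (s + N * a)
    rwa [Nat.cast_mul, mul_assoc] at hshift
  have hlong : N * a ≤ dist (γ s) (γ (s + N * a)) := hb.le_dist_of_periodic (by linarith) hper
  have hrest := hlip t (s + N * a)
  rw [abs_sub_comm, abs_of_nonneg (by linarith)] at hrest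
  rw [abs_sub_comm, abs_of_nonneg (sub_nonneg.2 hst)]
  linarith [dist_triangle (γ s) (γ t) (γ (s + N * a))]

theorem apply_line (hb : IsBusemannFunction γ b) (hline : ∀ s t, dist (γ s) (γ t) = |s - t|)
    (t : ℝ) : b (γ t) = -t := by
  refine tendsto_nhds_unique (hb (γ t)) (tendsto_const_nhds.congr' ?_)
  filter_upwards [eventually_ge_atTop t] with r hr
  rw [hline, abs_sub_comm, abs_of_nonneg (by linarith)]
  ring

theorem isLocalMin_add_reverse {b' : M → ℝ} {a : ℝ} (hb : IsBusemannFunction γ b)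
    (hb' : IsBusemannFunction (fun t ↦ γ (-t + 2 * a)) b')
    (hline : ∀ s t, dist (γ s) (γ t) = |s - t|) : IsLocalMin (b + b') (γ a) := by
  have hreverse : b' (γ a) = -a := by
    have hat := hb'.apply_line (fun s t ↦ by rw [hline, abs_sub_comm]; congr 1; ring) a
    rwa [show -a + 2 * a = a by ring] at hat
  have hlower (x : M) : -a + -a ≤ b x + b' x := by
    refine ge_of_tendsto ((hb x).add (hb' x)) ?_
    filter_upwards [eventually_ge_atTop a] with t ht
    have htriangle := dist_triangle_left (γ t) (γ (-t + 2 * a)) x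
    rw [hline, abs_of_nonneg (by linarith)] at htriangle
    linarith
  refine Eventually.of_forall fun x ↦ ?_
  rw [Pi.add_apply, Pi.add_apply, hb.apply_line hline, hreverse]
  exact hlower x

end IsBusemannFunction

end Busemann

section Paths

open Manifold

variable {E : Type*} [NormedAddCommGroup E] [NormedSpace ℝ E]
  {M : Type*} [MetricSpace M] [ChartedSpace E M]

/-- The differential `db` of a real function, with values in the dual of the tangent space. -/
noncomputable def differential (b : M → ℝ) (x : M) : TangentSpace 𝓘(ℝ, E) x →L[ℝ] ℝ :=
  mfderiv 𝓘(ℝ, E) 𝓘(ℝ, ℝ) b x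

variable [RiemannianBundle (fun x : M ↦ TangentSpace 𝓘(ℝ, E) x)]

theorem abs_sub_le_of_path {b : M → ℝ} (hb : ContMDiff 𝓘(ℝ, E) 𝓘(ℝ, ℝ) 1 b) {γ : ℝ → M}
    (hγ : ContMDiff 𝓘(ℝ, ℝ) 𝓘(ℝ, E) 1 γ) {k l : ℝ} (hk : 0 ≤ k) (hl : 0 ≤ l)
    (hlen : pathELength 𝓘(ℝ, E) γ 0 1 ≤ ENNReal.ofReal l)
    (hbound : ∀ t ∈ Set.Icc (0 : ℝ) 1, ∀ u : TangentSpace 𝓘(ℝ, E) (γ t),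
      |differential b (γ t) u| ≤ k * ‖u‖) :
    |b (γ 0) - b (γ 1)| ≤ k * l := by
  have hedist : edist (b (γ 0)) (b (γ 1)) ≤ pathELength 𝓘(ℝ, ℝ) (b ∘ γ) 0 1 := by
    rw [IsRiemannianManifold.out (I := 𝓘(ℝ, ℝ)) (b (γ 0))]
    exact riemannianEDist_le_pathELength (hb.comp hγ).contMDiffOn rfl rfl zero_le_one
  have himage : pathELength 𝓘(ℝ, ℝ) (b ∘ γ) 0 1 ≤
      ENNReal.ofReal k * pathELength 𝓘(ℝ, E) γ 0 1 := by
    rw [pathELength_eq_lintegral_mfderiv_Icc, pathELength_eq_lintegral_mfderiv_Icc,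
      ← MeasureTheory.lintegral_const_mul' _ _ ENNReal.ofReal_ne_top]
    refine MeasureTheory.setLIntegral_mono' measurableSet_Icc fun t ht ↦ ?_
    rw [mfderiv_comp t ((hb _).mdifferentiableAt (by simp)) ((hγ t).mdifferentiableAt (by simp)),
      enorm_tangentSpace_vectorSpace]
    refine (Real.enorm_eq_ofReal_abs _).trans_le ((ENNReal.ofReal_le_ofReal
      (hbound t ht (mfderiv 𝓘(ℝ, ℝ) 𝓘(ℝ, E) γ t (1 : ℝ)))).trans_eq ?_)
    rw [ENNReal.ofReal_mul hk, ofReal_norm]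
    rfl
  have hle := hedist.trans (himage.trans (mul_le_mul_right hlen _))
  rwa [← ENNReal.ofReal_mul hk, edist_dist, ENNReal.ofReal_le_ofReal_iff (by positivity)] at hle

variable [IsRiemannianManifold 𝓘(ℝ, E) M]

variable (E) in
theorem exists_path_of_dist_lt {x y : M} {r : ℝ} (h : dist x y < r) :
    ∃ γ : ℝ → M, γ 0 = x ∧ γ 1 = y ∧ ContMDiff 𝓘(ℝ, ℝ) 𝓘(ℝ, E) 1 γ ∧
      pathELength 𝓘(ℝ, E) γ 0 1 < ENNReal.ofReal r := by
  have hr : riemannianEDist 𝓘(ℝ, E) x y < ENNReal.ofReal r := by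
    rwa [← IsRiemannianManifold.out (I := 𝓘(ℝ, E)) x y, edist_lt_ofReal]
  obtain ⟨γ, hγ0, hγ1, hγ, hlen, -⟩ :=
    exists_lt_locally_constant_of_riemannianEDist_lt hr zero_lt_one
  exact ⟨γ, hγ0, hγ1, hγ, hlen⟩

theorem edist_add_edist_le_pathELength {γ : ℝ → M} (hγ : ContMDiff 𝓘(ℝ, ℝ) 𝓘(ℝ, E) 1 γ)
    {r s t : ℝ} (hrs : r ≤ s) (hst : s ≤ t) :
    edist (γ r) (γ s) + edist (γ s) (γ t) ≤ pathELength 𝓘(ℝ, E) γ r t := by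
  have hle {r s : ℝ} (hrs : r ≤ s) : edist (γ r) (γ s) ≤ pathELength 𝓘(ℝ, E) γ r s := by
    rw [IsRiemannianManifold.out (I := 𝓘(ℝ, E)) (γ r)]
    exact riemannianEDist_le_pathELength hγ.contMDiffOn rfl rfl hrs
  exact (add_le_add (hle hrs) (hle hst)).trans_eq (pathELength_add hrs hst)

theorem eventually_abs_sub_le_mul_dist {b : M → ℝ} (hb : ContMDiff 𝓘(ℝ, E) 𝓘(ℝ, ℝ) 1 b) {x : M}
    {k : ℝ} (hk : 0 ≤ k)
    (hbound : ∀ᶠ z in 𝓝 x, ∀ u : TangentSpace 𝓘(ℝ, E) z, |differential b z u| ≤ k * ‖u‖) :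
    ∀ᶠ z in 𝓝 x, |b x - b z| ≤ k * dist x z := by
  obtain ⟨ρ, hρ, hball⟩ := Metric.eventually_nhds_iff.1 hbound
  filter_upwards [Metric.ball_mem_nhds x hρ] with z hz
  rw [Metric.mem_ball, dist_comm] at hz
  have hlength : ∀ l ∈ Set.Ioo (dist x z) ρ, |b x - b z| ≤ k * l := fun l ⟨hl, hlρ⟩ ↦ by
    obtain ⟨γ, rfl, rfl, hγ, hlen⟩ := exists_path_of_dist_lt E hl
    refine abs_sub_le_of_path hb hγ hk (dist_nonneg.trans hl.le) hlen.le fun t ht ↦ hball ?_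
    have hstay : edist (γ 0) (γ t) < ENNReal.ofReal l :=
      (le_self_add.trans (edist_add_edist_le_pathELength hγ ht.1 ht.2)).trans_lt hlen
    rw [edist_lt_ofReal, dist_comm] at hstay
    exact hstay.trans hlρ
  have hlim : Tendsto (fun l ↦ k * l) (𝓝[>] dist x z) (𝓝 (k * dist x z)) :=
    (tendsto_id.const_mul k).mono_left nhdsWithin_le_nhds
  exact ge_of_tendsto hlim (eventually_of_mem (Ioo_mem_nhdsGT hz) hlength)

theorem exists_dist_eq_dist_le (E : Type*) [NormedAddCommGroup E] [NormedSpace ℝ E]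
    {M : Type*} [MetricSpace M] [ChartedSpace E M]
    [RiemannianBundle (fun x : M ↦ TangentSpace 𝓘(ℝ, E) x)] [IsRiemannianManifold 𝓘(ℝ, E) M]
    {x y : M} {r δ : ℝ} (hr : 0 ≤ r) (hrd : r ≤ dist x y) (hδ : 0 < δ) :
    ∃ z, dist x z = r ∧ dist z y ≤ dist x y - r + δ := by
  obtain ⟨γ, rfl, rfl, hγ, hlen⟩ := exists_path_of_dist_lt E (lt_add_of_pos_right (dist x y) hδ)
  have hcont : ContinuousOn (fun t ↦ dist (γ 0) (γ t)) (Set.Icc 0 1) :=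
    (continuous_const.dist hγ.continuous).continuousOn
  obtain ⟨t, ht, htr⟩ := intermediate_value_Icc zero_le_one hcont
    (show r ∈ Set.Icc (dist (γ 0) (γ 0)) (dist (γ 0) (γ 1)) from ⟨by rwa [dist_self], hrd⟩)
  refine ⟨γ t, htr, ?_⟩
  have hsum := (edist_add_edist_le_pathELength hγ ht.1 ht.2).trans_lt hlen
  rw [edist_dist, edist_dist, ← ENNReal.ofReal_add dist_nonneg dist_nonneg,
    ENNReal.ofReal_lt_ofReal_iff (by positivity)] at hsum
  simp only at htr
  linarith

theorem IsBusemannFunction.exists_le_sub (E : Type*) [NormedAddCommGroup E] [NormedSpace ℝ E]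
    {M : Type*} [MetricSpace M] [ChartedSpace E M]
    [RiemannianBundle (fun x : M ↦ TangentSpace 𝓘(ℝ, E) x)] [IsRiemannianManifold 𝓘(ℝ, E) M]
    {γ : ℝ → M} {b : M → ℝ} (hb : IsBusemannFunction γ b) {x : M} {r : ℝ} (hr : 0 ≤ r)
    (hcomp : IsCompact (Metric.closedBall x r)) : ∃ z, dist x z = r ∧ b z ≤ b x - r := by
  obtain ⟨N, hN⟩ := eventually_atTop.1 (((hb.tendsto_dist_atTop x).comp
    tendsto_natCast_atTop_atTop).eventually_ge_atTop r)
  have hpoint (n : ℕ) : ∃ z, dist x z = r ∧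
      dist z (γ (N + n : ℕ)) ≤ dist x (γ (N + n : ℕ)) - r + 1 / (n + 1 : ℝ) :=
    exists_dist_eq_dist_le E hr (hN _ (by omega)) (by positivity)
  choose z hzr hzγ using hpoint
  obtain ⟨w, -, φ, hφ, hlim⟩ := hcomp.tendsto_subseq (x := z) fun n ↦ by
    rw [Metric.mem_closedBall, dist_comm, hzr]
  have hwr : dist x w = r := tendsto_nhds_unique (tendsto_const_nhds.dist hlim)
    (tendsto_const_nhds.congr fun n ↦ (hzr (φ n)).symm)
  have htime : Tendsto (fun n : ℕ ↦ ((N + φ n : ℕ) : ℝ)) atTop atTop :=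
    tendsto_natCast_atTop_atTop.comp
      (tendsto_atTop_mono (fun n ↦ Nat.le_add_left _ _) hφ.tendsto_atTop)
  have hsmall : Tendsto (fun n ↦ 1 / ((φ n : ℝ) + 1) + dist w (z (φ n))) atTop (𝓝 0) := by
    simpa using (tendsto_one_div_add_atTop_nhds_zero_nat.comp hφ.tendsto_atTop).add
      ((tendsto_const_nhds (x := w)).dist hlim)
  have hlimit := (((hb x).comp htime).sub_const r).add hsmall
  rw [add_zero] at hlimit
  refine ⟨w, hwr, le_of_tendsto_of_tendsto ((hb w).comp htime) hlimit
    (Eventually.of_forall fun n ↦ ?_)⟩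
  simp only [Function.comp_apply]
  linarith [hzγ (φ n), dist_triangle w (z (φ n)) (γ (N + φ n : ℕ))]

end Paths

/-! ### Hessians and gradients on manifolds -/

section Hessian

section Coordinates

variable {E : Type*} [NormedAddCommGroup E] [NormedSpace ℝ E] {G : E → E →L[ℝ] E →L[ℝ] ℝ}
  {f f' : E → ℝ} {y : E}

theorem coordHessian_add (hf : ContDiffAt ℝ 2 f y) (hf' : ContDiffAt ℝ 2 f' y) :
    coordHessian G (f + f') y = coordHessian G f y + coordHessian G f' y := by
  have hfst : fderiv ℝ (f + f') =ᶠ[𝓝 y] fun x ↦ fderiv ℝ f x + fderiv ℝ f' x := by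
    filter_upwards [hf.eventually (by simp), hf'.eventually (by simp)] with x hx hx'
    exact fderiv_add (hx.differentiableAt (by simp)) (hx'.differentiableAt (by simp))
  have hsnd : fderiv ℝ (fderiv ℝ (f + f')) y =
      fderiv ℝ (fderiv ℝ f) y + fderiv ℝ (fderiv ℝ f') y := by
    rw [hfst.fderiv_eq]
    exact ((hasFDerivAt_fderiv hf).add (hasFDerivAt_fderiv hf')).fderiv
  ext u w
  simp only [coordHessian, hsnd, hfst.self_of_nhds, sub_apply, add_apply,
    ContinuousLinearMap.comp_apply, ContinuousLinearMap.compL_apply]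
  ring

theorem coordHessian_nonneg_of_isLocalMin (hmin : IsLocalMin f y) (hf : ContDiffAt ℝ 2 f y)
    (u : E) : 0 ≤ coordHessian G f y u u := by
  simpa [coordHessian, hmin.fderiv_eq_zero] using fderiv_fderiv_nonneg_of_isLocalMin hmin hf u

end Coordinates

variable {E : Type*} [NormedAddCommGroup E] [NormedSpace ℝ E]
  {M : Type*} [TopologicalSpace M] [ChartedSpace E M]
  [RiemannianBundle (fun x : M ↦ TangentSpace 𝓘(ℝ, E) x)]

/-- The Hessian `∇df` of a function on `M`, computed in the chart centred at the point. -/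
noncomputable def hessian (f : M → ℝ) (p : M) (u w : TangentSpace 𝓘(ℝ, E) p) : ℝ :=
  coordHessian (chartMetric p) (f ∘ (extChartAt 𝓘(ℝ, E) p).symm) (extChartAt 𝓘(ℝ, E) p p)
    (coord p p u) (coord p p w)

variable [IsManifold 𝓘(ℝ, E) ∞ M] {f f' : M → ℝ} {p : M}

theorem hessian_add (hf : ContMDiffAt 𝓘(ℝ, E) 𝓘(ℝ, ℝ) 2 f p)
    (hf' : ContMDiffAt 𝓘(ℝ, E) 𝓘(ℝ, ℝ) 2 f' p) (u w : TangentSpace 𝓘(ℝ, E) p) :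
    hessian (f + f') p u w = hessian f p u w + hessian f' p u w :=
  congrArg (fun H : E →L[ℝ] E →L[ℝ] ℝ ↦ H (coord p p u) (coord p p w))
    (coordHessian_add (contDiffAt_comp_extChartAt_symm hf (mem_extChartAt_source p))
      (contDiffAt_comp_extChartAt_symm hf' (mem_extChartAt_source p)))

theorem hessian_nonneg_of_isLocalMin (hmin : IsLocalMin f p)
    (hf : ContMDiffAt 𝓘(ℝ, E) 𝓘(ℝ, ℝ) 2 f p) (u : TangentSpace 𝓘(ℝ, E) p) :
    0 ≤ hessian f p u u := by
  refine coordHessian_nonneg_of_isLocalMin ?_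
    (contDiffAt_comp_extChartAt_symm hf (mem_extChartAt_source p)) _
  have hcont : Tendsto (extChartAt 𝓘(ℝ, E) p).symm (𝓝 (extChartAt 𝓘(ℝ, E) p p)) (𝓝 p) := by
    simpa only [ContinuousAt, extChartAt_to_inv] using
      continuousAt_extChartAt_symm (I := 𝓘(ℝ, E)) p
  refine (hcont.eventually hmin).mono fun y hy ↦ ?_
  rwa [Function.comp_apply, extChartAt_to_inv]

variable [FiniteDimensional ℝ E]
  [IsContMDiffRiemannianBundle 𝓘(ℝ, E) ∞ E (fun x : M ↦ TangentSpace 𝓘(ℝ, E) x)]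

theorem coordHessian_coord {c x : M} (hf : ContMDiffAt 𝓘(ℝ, E) 𝓘(ℝ, ℝ) 2 f x)
    (hx : x ∈ (extChartAt 𝓘(ℝ, E) c).source) (u w : TangentSpace 𝓘(ℝ, E) x) :
    coordHessian (chartMetric c) (f ∘ (extChartAt 𝓘(ℝ, E) c).symm) (extChartAt 𝓘(ℝ, E) c x)
      (coord c x u) (coord c x w) = hessian f x u w := by
  have hid : mfderiv 𝓘(ℝ, E) 𝓘(ℝ, E) (fun x : M ↦ x) x = ContinuousLinearMap.id ℝ _ := mfderiv_id
  have hcomp := (IsRiemannianIsometry.id (E := E)).coordHessian_comp hx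
    (mem_extChartAt_source (I := 𝓘(ℝ, E)) x) hf u w
  rw [hid] at hcomp
  exact hcomp

theorem IsSymmetryAt.hessian_comp {s : Equiv.Perm M} (hs : IsSymmetryAt E p s)
    (hf : ContMDiffAt 𝓘(ℝ, E) 𝓘(ℝ, ℝ) 2 f p) (u w : TangentSpace 𝓘(ℝ, E) p) :
    hessian (f ∘ s) p u w = hessian f p u w := by
  have hp := mem_extChartAt_source (I := 𝓘(ℝ, E)) p
  have hcomp := hs.isRiemannianIsometry.coordHessian_comp hp (by rwa [hs.apply_self])
    (by rwa [hs.apply_self]) u w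
  rw [hs.coord_mfderiv, hs.coord_mfderiv, hs.apply_self, map_neg, map_neg, neg_apply,
    neg_neg] at hcomp
  exact hcomp

theorem hessian_eq_zero_of_nonneg (hf : ContMDiffAt 𝓘(ℝ, E) 𝓘(ℝ, ℝ) 2 f p)
    (hpos : ∀ u : TangentSpace 𝓘(ℝ, E) p, 0 ≤ hessian f p u u)
    (hlap : laplacian E f p ≤ 0)
    (u w : TangentSpace 𝓘(ℝ, E) p) : hessian f p u w = 0 := by
  have hp := mem_extChartAt_source (I := 𝓘(ℝ, E)) p
  have hmet := isMetricOn_chartMetric (E := E) p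
  have hy := (extChartAt 𝓘(ℝ, E) p).map_source hp
  rw [hessian, hmet.eq_zero_of_nonneg_of_trace_nonpos hy
    (hmet.coordHessian_symm hy (contDiffAt_comp_extChartAt_symm hf hp)) (fun u' ↦ ?_) hlap]
  · rfl
  · obtain ⟨u, rfl⟩ := surjective_coord hp u'
    exact hpos u

-- The symmetry turns `f'` into `f`, so the Hessian of `f + f'` at its minimum `p` is `2 ∇df`.
theorem IsSymmetryAt.hessian_eq_zero {s : Equiv.Perm M} (hs : IsSymmetryAt E p s)
    (hf : ContMDiffAt 𝓘(ℝ, E) 𝓘(ℝ, ℝ) 2 f p) (hf' : ContMDiffAt 𝓘(ℝ, E) 𝓘(ℝ, ℝ) 2 f' p)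
    (hsf : f' ∘ s = f) (hmin : IsLocalMin (f + f') p) (hlap : laplacian E f p ≤ 0)
    (u w : TangentSpace 𝓘(ℝ, E) p) : hessian f p u w = 0 := by
  refine hessian_eq_zero_of_nonneg hf (fun u ↦ ?_) hlap u w
  have hreflect : hessian f p u u = hessian f' p u u := by rw [← hs.hessian_comp hf', hsf]
  have hsum := hessian_nonneg_of_isLocalMin hmin (hf.add hf') u
  rw [hessian_add hf hf'] at hsum
  linarith

end Hessian

section Differential

variable {E : Type*} [NormedAddCommGroup E] [NormedSpace ℝ E]
  {M : Type*} [MetricSpace M] [ChartedSpace E M] {f : M → ℝ}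

theorem hasDerivAt_comp_velocity {γ : ℝ → M} {t : ℝ}
    (hf : MDifferentiableAt 𝓘(ℝ, E) 𝓘(ℝ, ℝ) f (γ t))
    (hγ : MDifferentiableAt 𝓘(ℝ, ℝ) 𝓘(ℝ, E) γ t) :
    HasDerivAt (f ∘ γ) (differential f (γ t) (velocity E γ t)) t := by
  have hcomp : HasFDerivAt (𝕜 := ℝ) (f ∘ γ) _ t :=
    (hf.hasMFDerivAt.comp t hγ.hasMFDerivAt).hasFDerivAt
  exact hcomp.hasDerivAt

theorem fderiv_comp_extChartAt_symm_coord [IsManifold 𝓘(ℝ, E) ∞ M] {c x : M}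
    (hf : MDifferentiableAt 𝓘(ℝ, E) 𝓘(ℝ, ℝ) f x) (hx : x ∈ (extChartAt 𝓘(ℝ, E) c).source)
    (u : TangentSpace 𝓘(ℝ, E) x) :
    fderiv ℝ (f ∘ (extChartAt 𝓘(ℝ, E) c).symm) (extChartAt 𝓘(ℝ, E) c x) (coord c x u) =
      differential f x u := by
  have hsymm : MDifferentiableAt 𝓘(ℝ, E) 𝓘(ℝ, E) (extChartAt 𝓘(ℝ, E) c).symm
      (extChartAt 𝓘(ℝ, E) c x) :=
    (contMDiffAt_extChartAt_symm ((extChartAt 𝓘(ℝ, E) c).map_source hx)).mdifferentiableAt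
      (by simp)
  have hread : MDifferentiableAt 𝓘(ℝ, E) 𝓘(ℝ, ℝ) (f ∘ (extChartAt 𝓘(ℝ, E) c).symm)
      (extChartAt 𝓘(ℝ, E) c x) :=
    MDifferentiableAt.comp _ (by rwa [(extChartAt 𝓘(ℝ, E) c).left_inv hx]) hsymm
  have hchain := hread.hasMFDerivAt.comp x (mdifferentiableAt_extChartAt_of_mem hx).hasMFDerivAt
  have hleft : f =ᶠ[𝓝 x] (f ∘ (extChartAt 𝓘(ℝ, E) c).symm) ∘ extChartAt 𝓘(ℝ, E) c := by
    filter_upwards [extChartAt_source_mem_nhds' hx] with z hz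
    simp only [Function.comp_apply, (extChartAt 𝓘(ℝ, E) c).left_inv hz]
  rw [← mfderiv_eq_fderiv]
  exact congrArg (fun L ↦ L u) (hchain.congr_of_eventuallyEq hleft).mfderiv.symm

end Differential

section RiemannianGradient

variable {E : Type*} [NormedAddCommGroup E] [NormedSpace ℝ E]
  {M : Type*} [MetricSpace M] [ChartedSpace E M]
  [RiemannianBundle (fun x : M ↦ TangentSpace 𝓘(ℝ, E) x)]

variable (E) in
/-- The Riemannian gradient `∇f` of a function on `M`, computed in the chart centred at the
point. -/
noncomputable def gradient (f : M → ℝ) (p : M) : TangentSpace 𝓘(ℝ, E) p :=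
  (coord p p).inverse (coordGradient (chartMetric p) (f ∘ (extChartAt 𝓘(ℝ, E) p).symm)
    (extChartAt 𝓘(ℝ, E) p p))

variable [FiniteDimensional ℝ E] [IsManifold 𝓘(ℝ, E) ∞ M]
  [IsContMDiffRiemannianBundle 𝓘(ℝ, E) ∞ E (fun x : M ↦ TangentSpace 𝓘(ℝ, E) x)]
  {f : M → ℝ} {c x : M}

theorem inner_gradient (hf : MDifferentiableAt 𝓘(ℝ, E) 𝓘(ℝ, ℝ) f x)
    (u : TangentSpace 𝓘(ℝ, E) x) : inner ℝ (gradient E f x) u = differential f x u := by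
  have hx := mem_extChartAt_source (I := 𝓘(ℝ, E)) x
  rw [← chartMetric_coord hx, gradient, (isInvertible_coord hx).self_apply_inverse,
    (isMetricOn_chartMetric x).apply_coordGradient ((extChartAt 𝓘(ℝ, E) x).map_source hx),
    fderiv_comp_extChartAt_symm_coord hf hx]

theorem coord_gradient (hf : MDifferentiableAt 𝓘(ℝ, E) 𝓘(ℝ, ℝ) f x)
    (hx : x ∈ (extChartAt 𝓘(ℝ, E) c).source) :
    coord c x (gradient E f x) =
      coordGradient (chartMetric c) (f ∘ (extChartAt 𝓘(ℝ, E) c).symm)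
        (extChartAt 𝓘(ℝ, E) c x) := by
  have hy := (extChartAt 𝓘(ℝ, E) c).map_source hx
  refine (isMetricOn_chartMetric c).eq_of_forall hy fun u' ↦ ?_
  obtain ⟨u, rfl⟩ := surjective_coord hx u'
  rw [chartMetric_coord hx, inner_gradient hf, (isMetricOn_chartMetric c).apply_coordGradient hy,
    fderiv_comp_extChartAt_symm_coord hf hx]

theorem chartMetric_coordGradient_self (hf : MDifferentiableAt 𝓘(ℝ, E) 𝓘(ℝ, ℝ) f x)
    (hx : x ∈ (extChartAt 𝓘(ℝ, E) c).source) :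
    chartMetric c (extChartAt 𝓘(ℝ, E) c x)
      (coordGradient (chartMetric c) (f ∘ (extChartAt 𝓘(ℝ, E) c).symm) (extChartAt 𝓘(ℝ, E) c x))
      (coordGradient (chartMetric c) (f ∘ (extChartAt 𝓘(ℝ, E) c).symm)
        (extChartAt 𝓘(ℝ, E) c x)) = ‖gradient E f x‖ ^ 2 := by
  rw [← coord_gradient hf hx, chartMetric_coord hx, real_inner_self_eq_norm_sq]

theorem abs_differential_le (hf : MDifferentiableAt 𝓘(ℝ, E) 𝓘(ℝ, ℝ) f x)
    (u : TangentSpace 𝓘(ℝ, E) x) : |differential f x u| ≤ ‖gradient E f x‖ * ‖u‖ :=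
  inner_gradient hf u ▸ abs_real_inner_le_norm _ _

theorem continuous_norm_gradient (hf : ContMDiff 𝓘(ℝ, E) 𝓘(ℝ, ℝ) 2 f) :
    Continuous fun x ↦ ‖gradient E f x‖ := by
  refine continuous_iff_continuousAt.2 fun x ↦ ?_
  have hx := mem_extChartAt_source (I := 𝓘(ℝ, E)) x
  have hy := (extChartAt 𝓘(ℝ, E) x).map_source hx
  have hmet := isMetricOn_chartMetric (E := E) x
  have hgrad := (hmet.contDiffAt_coordGradient hy
    (contDiffAt_comp_extChartAt_symm (hf x) hx)).continuousAt
  have hsq := ContinuousAt.comp (f := extChartAt 𝓘(ℝ, E) x)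
    (((hmet.contDiffAt hy).continuousAt.clm_apply hgrad).clm_apply hgrad)
    (continuousAt_extChartAt' hx)
  refine (Real.continuous_sqrt.continuousAt.comp hsq).congr ?_
  filter_upwards [extChartAt_source_mem_nhds' hx] with z hz
  simp only [Function.comp_apply]
  rw [chartMetric_coordGradient_self ((hf z).mdifferentiableAt (by simp)) hz,
    Real.sqrt_sq (norm_nonneg _)]

theorem velocity_eq_neg_gradient {γ : ℝ → M} {t : ℝ}
    (hf : MDifferentiableAt 𝓘(ℝ, E) 𝓘(ℝ, ℝ) f (γ t))
    (hγ : MDifferentiableAt 𝓘(ℝ, ℝ) 𝓘(ℝ, E) γ t) (hspeed : ‖velocity E γ t‖ = 1)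
    (hgrad : ‖gradient E f (γ t)‖ = 1) (hslope : HasDerivAt (f ∘ γ) (-1) t) :
    velocity E γ t = -gradient E f (γ t) := by
  have hinner : inner ℝ (velocity E γ t) (gradient E f (γ t)) = -1 := by
    rw [real_inner_comm, inner_gradient hf]
    exact (hasDerivAt_comp_velocity hf hγ).unique hslope
  have hsum : ‖velocity E γ t + gradient E f (γ t)‖ ^ 2 = 0 := by
    rw [norm_add_sq_real, hspeed, hgrad, hinner]
    norm_num
  exact eq_neg_of_add_eq_zero_left (norm_eq_zero.1 (pow_eq_zero_iff two_ne_zero |>.1 hsum))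

variable [IsRiemannianManifold 𝓘(ℝ, E) M]

-- Along the unit speed geodesic in the direction of the gradient, `f` has derivative `‖∇f‖`.
theorem norm_gradient_le_one (hsym : IsSymmetricSpace E M)
    (hf : MDifferentiableAt 𝓘(ℝ, E) 𝓘(ℝ, ℝ) f x) (hlip : ∀ z z', |f z - f z'| ≤ dist z z') :
    ‖gradient E f x‖ ≤ 1 := by
  rcases eq_or_ne (gradient E f x) 0 with hzero | hne
  · simp [hzero]
  have hnorm : ‖gradient E f x‖ ≠ 0 := norm_ne_zero_iff.2 hne
  obtain ⟨σ, hσ, hstart, -⟩ := hsym.exists_isUnitSpeedGeodesic x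
    (‖gradient E f x‖⁻¹ • gradient E f x)
    (by rw [norm_smul, norm_inv, norm_norm, inv_mul_cancel₀ hnorm])
  have hslope : differential f (σ 0) (velocity E σ 0) = ‖gradient E f x‖ := by
    calc differential f (σ 0) (velocity E σ 0)
        = differential f x (‖gradient E f x‖⁻¹ • gradient E f x) :=
          congrArg (fun X : TangentBundle 𝓘(ℝ, E) M ↦ differential f X.proj X.snd) hstart
      _ = ‖gradient E f x‖⁻¹ * ‖gradient E f x‖ ^ 2 := by
          rw [map_smul, ← inner_gradient hf, real_inner_self_eq_norm_sq, smul_eq_mul]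
      _ = ‖gradient E f x‖ := by field_simp
  have hσ0 : σ 0 = x := congrArg TotalSpace.proj hstart
  have hderiv := hasDerivAt_comp_velocity (hσ0 ▸ hf)
    ((hσ.contMDiff 0).mdifferentiableAt (by simp))
  rw [hslope] at hderiv
  have hbound := hderiv.le_of_lip' (C := 1) zero_le_one (Eventually.of_forall fun t ↦ by
    rw [Function.comp_apply, Function.comp_apply, one_mul, Real.norm_eq_abs, Real.norm_eq_abs]
    exact (hlip _ _).trans (hσ.dist_le _ _))
  rwa [norm_norm] at hbound

theorem IsBusemannFunction.norm_gradient_eq_one (hsym : IsSymmetricSpace E M) {γ : ℝ → M}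
    {b : M → ℝ} (hb : IsBusemannFunction γ b) (hb₂ : ContMDiff 𝓘(ℝ, E) 𝓘(ℝ, ℝ) 2 b) (x : M) :
    ‖gradient E b x‖ = 1 := by
  have hdiff (z : M) : MDifferentiableAt 𝓘(ℝ, E) 𝓘(ℝ, ℝ) b z := (hb₂ z).mdifferentiableAt (by simp)
  refine le_antisymm (norm_gradient_le_one hsym (hdiff x) hb.abs_sub_le_dist)
    (le_of_not_gt fun hlt ↦ ?_)
  obtain ⟨k, hk, hk1⟩ := exists_between hlt
  have hslow : ∀ᶠ z in 𝓝 x, |b x - b z| ≤ k * dist x z := by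
    refine eventually_abs_sub_le_mul_dist (hb₂.of_le (by norm_num)) ((norm_nonneg _).trans hk.le) ?_
    filter_upwards [(continuous_norm_gradient hb₂).continuousAt.eventually (Iio_mem_nhds hk)]
      with z hz u
    exact (abs_differential_le (hdiff z) u).trans (by gcongr)
  have := Manifold.locallyCompact_of_finiteDimensional (M := M) 𝓘(ℝ, E)
  obtain ⟨ρ, hρ, hball⟩ := Metric.eventually_nhds_iff.1 hslow
  obtain ⟨r₀, hr₀, hcomp⟩ := Metric.exists_isCompact_closedBall x
  obtain ⟨r, hr, hrmin⟩ := exists_between (lt_min hr₀ hρ)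
  obtain ⟨hrr₀, hrρ⟩ := lt_min_iff.1 hrmin
  obtain ⟨z, hz, hbz⟩ := hb.exists_le_sub E hr.le (hcomp.of_isClosed_subset
    Metric.isClosed_closedBall (Metric.closedBall_subset_closedBall hrr₀.le))
  have hbound := (le_abs_self _).trans (hball (y := z) (by rwa [dist_comm, hz]))
  rw [hz] at hbound
  nlinarith

end RiemannianGradient

/-! ### Flatness -/

section Flatness

variable {E : Type*} [NormedAddCommGroup E] [NormedSpace ℝ E]
  {M : Type*} [MetricSpace M] [ChartedSpace E M] [IsManifold 𝓘(ℝ, E) ∞ M]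
  [RiemannianBundle (fun x : M ↦ TangentSpace 𝓘(ℝ, E) x)]

theorem curvature_eq_zero_iff {p : M} {u v w : TangentSpace 𝓘(ℝ, E) p} :
    curvature p u v w = 0 ↔ coordCurvature (chartMetric p) (extChartAt 𝓘(ℝ, E) p p)
      (coord p p u) (coord p p v) (coord p p w) = 0 := by
  obtain ⟨e, he⟩ := isInvertible_coord (mem_extChartAt_source (I := 𝓘(ℝ, E)) p)
  rw [curvature, ← he, ContinuousLinearMap.inverse_equiv]
  exact e.symm.map_eq_zero_iff

variable [FiniteDimensional ℝ E]
  [IsContMDiffRiemannianBundle 𝓘(ℝ, E) ∞ E (fun x : M ↦ TangentSpace 𝓘(ℝ, E) x)]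

theorem IsUnitSpeedGeodesic.comp_isometry {γ : ℝ → M} (hγ : IsUnitSpeedGeodesic E γ) {s : M → M}
    (hs : IsRiemannianIsometry E s) : IsUnitSpeedGeodesic E (s ∘ γ) where
  toIsGeodesic := isGeodesic_iff.2 fun t ↦ (isGeodesic_iff.1 hγ.toIsGeodesic t).comp_isometry hs
  norm_velocity t := by
    rw [velocity, mfderiv_comp t ((hs.contMDiff _).mdifferentiableAt (by simp))
      ((hγ.contMDiff t).mdifferentiableAt (by simp))]
    exact (hs.norm_mfderiv (γ t) (velocity E γ t)).trans (hγ.norm_velocity t)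

theorem isFlat_of_curvature_eq_zero
    (h : ∀ (p : M) (w v : TangentSpace 𝓘(ℝ, E) p), ‖v‖ = 1 → curvature p w v v = 0) :
    IsFlat E M := by
  intro p u v w
  have hp := mem_extChartAt_source (I := 𝓘(ℝ, E)) p
  rw [curvature, (isMetricOn_chartMetric (E := E) p).coordCurvature_eq_zero_of_diagonal
    ((extChartAt 𝓘(ℝ, E) p).map_source hp), map_zero]
  intro w' v'
  obtain ⟨w, rfl⟩ := surjective_coord hp w'
  obtain ⟨v, rfl⟩ := surjective_coord hp v'
  rcases eq_or_ne v 0 with rfl | hv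
  · simp [coordCurvature]
  have hnorm : ‖v‖ ≠ 0 := norm_ne_zero_iff.2 hv
  have hunit := h p w (‖v‖⁻¹ • v) (by rw [norm_smul, norm_inv, norm_norm, inv_mul_cancel₀ hnorm])
  rw [curvature_eq_zero_iff, map_smul, coordCurvature_smul_smul] at hunit
  exact (smul_eq_zero.1 hunit).resolve_left (by positivity)

theorem curvature_velocity_eq_zero_of_eikonal {f : M → ℝ} (hf : ContMDiff 𝓘(ℝ, E) 𝓘(ℝ, ℝ) 2 f)
    (heik : ∀ x, ‖gradient E f x‖ = 1) {γ : ℝ → M} (hγ : ContMDiff 𝓘(ℝ, ℝ) 𝓘(ℝ, E) 1 γ)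
    (hvel : ∀ t, velocity E γ t = -gradient E f (γ t))
    (hhess : ∀ (t : ℝ) (u w : TangentSpace 𝓘(ℝ, E) (γ t)), hessian f (γ t) u w = 0)
    (w : TangentSpace 𝓘(ℝ, E) (γ 0)) :
    curvature (γ 0) w (velocity E γ 0) (velocity E γ 0) = 0 := by
  have hdiff (x : M) : MDifferentiableAt 𝓘(ℝ, E) 𝓘(ℝ, ℝ) f x := (hf x).mdifferentiableAt (by simp)
  have hdiffγ (t : ℝ) : MDifferentiableAt 𝓘(ℝ, ℝ) 𝓘(ℝ, E) γ t :=
    (hγ t).mdifferentiableAt (by simp)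
  have hsource := mem_extChartAt_source (I := 𝓘(ℝ, E)) (γ 0)
  have htarget := (extChartAt 𝓘(ℝ, E) (γ 0)).map_source hsource
  have hnear : ∀ᶠ t in 𝓝 0, γ t ∈ (extChartAt 𝓘(ℝ, E) (γ 0)).source :=
    hγ.continuous.continuousAt.eventually (extChartAt_source_mem_nhds (γ 0))
  have hchart : ∀ᶠ y in 𝓝 (extChartAt 𝓘(ℝ, E) (γ 0) (γ 0)),
      ∃ x ∈ (extChartAt 𝓘(ℝ, E) (γ 0)).source, extChartAt 𝓘(ℝ, E) (γ 0) x = y :=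
    ((isMetricOn_chartMetric (γ 0)).eventually_mem htarget).mono fun y hy ↦
      ⟨_, (extChartAt 𝓘(ℝ, E) (γ 0)).map_target hy, (extChartAt 𝓘(ℝ, E) (γ 0)).right_inv hy⟩
  rw [curvature_eq_zero_iff, coord_velocity (hdiffγ 0) hsource]
  refine (isMetricOn_chartMetric (γ 0)).coordCurvature_eq_zero_of_eikonal
    (γ := extChartAt 𝓘(ℝ, E) (γ 0) ∘ γ) (f := f ∘ (extChartAt 𝓘(ℝ, E) (γ 0)).symm) htarget
    (hchart.mono ?_) (hchart.mono ?_) (hnear.mono fun t ht ↦ ?_) (hnear.mono fun t ht ↦ ?_) _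
  · rintro _ ⟨x, hx, rfl⟩
    exact contDiffAt_comp_extChartAt_symm (hf x) hx
  · rintro _ ⟨x, hx, rfl⟩
    rw [chartMetric_coordGradient_self (hdiff x) hx, heik, one_pow]
  · rw [Function.comp_apply, ← coord_gradient (hdiff _) ht, ← map_neg, ← hvel,
      coord_velocity (hdiffγ t) ht]
    exact ((contDiffAt_extChartAt_comp (by norm_cast) (hγ t) ht).differentiableAt
      (by simp)).hasDerivAt
  · ext u' w'
    obtain ⟨u, rfl⟩ := surjective_coord ht u'
    obtain ⟨w, rfl⟩ := surjective_coord ht w'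
    exact (coordHessian_coord (hf _) ht u w).trans (hhess t u w)

variable [IsRiemannianManifold 𝓘(ℝ, E) M]

theorem hessian_busemann_eq_zero (hsym : IsSymmetricSpace E M)
    (hbus : ∀ γ : ℝ → M, IsUnitSpeedGeodesic E γ →
      ∃ b : M → ℝ, IsBusemannFunction γ b ∧ ContMDiff 𝓘(ℝ, E) 𝓘(ℝ, ℝ) 2 b)
    {γ : ℝ → M} (hγ : IsUnitSpeedGeodesic E γ) (hline : ∀ s t, dist (γ s) (γ t) = |s - t|)
    {b : M → ℝ} (hb : IsBusemannFunction γ b) (hb₂ : ContMDiff 𝓘(ℝ, E) 𝓘(ℝ, ℝ) 2 b) (t : ℝ)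
    (hlap : laplacian E b (γ t) ≤ 0) (u w : TangentSpace 𝓘(ℝ, E) (γ t)) :
    hessian b (γ t) u w = 0 := by
  obtain ⟨s, hs⟩ := hsym.exists_isSymmetryAt (γ t)
  obtain ⟨b', hb', hb₂'⟩ := hbus (s ∘ γ) (hγ.comp_isometry hs.isRiemannianIsometry)
  have hpull : b' ∘ s = b := by
    refine IsBusemannFunction.unique (γ := γ) (fun x ↦ ?_) hb
    simpa only [Function.comp_apply, dist_apply_of_mem_isometryGroup hs.mem] using hb' (s x)
  have hreverse : s ∘ γ = fun r ↦ γ (-r + 2 * t) :=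
    funext fun r ↦ hs.apply_isGeodesic hγ.toIsGeodesic r
  exact hs.hessian_eq_zero (hb₂ _) (hb₂' _) hpull
    (hb.isLocalMin_add_reverse (hreverse ▸ hb') hline) hlap u w

theorem IsUnitSpeedGeodesic.velocity_eq_neg_gradient_busemann (hsym : IsSymmetricSpace E M)
    {γ : ℝ → M} (hγ : IsUnitSpeedGeodesic E γ) (hline : ∀ s t, dist (γ s) (γ t) = |s - t|)
    {b : M → ℝ} (hb : IsBusemannFunction γ b) (hb₂ : ContMDiff 𝓘(ℝ, E) 𝓘(ℝ, ℝ) 2 b) (t : ℝ) :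
    velocity E γ t = -gradient E b (γ t) := by
  refine velocity_eq_neg_gradient ((hb₂ _).mdifferentiableAt (by simp))
    ((hγ.contMDiff t).mdifferentiableAt (by simp)) (hγ.norm_velocity t)
    (hb.norm_gradient_eq_one hsym hb₂ _) ?_
  rw [show b ∘ γ = fun t ↦ -t from funext (hb.apply_line hline)]
  exact hasDerivAt_neg t

end Flatness

end RiemGeom

theorem theorem5_general {E : Type*} [NormedAddCommGroup E] [NormedSpace ℝ E]
    [FiniteDimensional ℝ E] {M : Type*} [MetricSpace M] [ChartedSpace E M] [IsManifold 𝓘(ℝ, E) ∞ M]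
    [RiemannianBundle (fun x : M ↦ TangentSpace 𝓘(ℝ, E) x)]
    [IsContMDiffRiemannianBundle 𝓘(ℝ, E) ∞ E (fun x : M ↦ TangentSpace 𝓘(ℝ, E) x)]
    [IsRiemannianManifold 𝓘(ℝ, E) M]
    (hbus : ∀ γ : ℝ → M, RiemGeom.IsUnitSpeedGeodesic E γ →
      ∃ b : M → ℝ, RiemGeom.IsBusemannFunction γ b ∧ ContMDiff 𝓘(ℝ, E) 𝓘(ℝ, ℝ) 2 b ∧
        ∀ x, RiemGeom.laplacian E b x ≤ 0)
    (hsym : RiemGeom.IsSymmetricSpace E M) :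
    RiemGeom.IsFlat E M := by
  refine RiemGeom.isFlat_of_curvature_eq_zero fun p w v hv ↦ ?_
  obtain ⟨γ, hγ, hstart, T, hT, a, ha, htrans⟩ := hsym.exists_isUnitSpeedGeodesic p v hv
  cases hstart
  obtain ⟨b, hb, hb₂, hlap⟩ := hbus γ hγ
  have hline := hb.dist_eq hγ.dist_le ha fun s t ↦ by
    rw [← htrans, ← htrans, RiemGeom.dist_apply_of_mem_isometryGroup hT]
  exact RiemGeom.curvature_velocity_eq_zero_of_eikonal hb₂ (hb.norm_gradient_eq_one hsym hb₂)
    (hγ.contMDiff.of_le (by norm_cast))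
    (hγ.velocity_eq_neg_gradient_busemann hsym hline hb hb₂)
    (fun t ↦ RiemGeom.hessian_busemann_eq_zero hsym
      (fun σ hσ ↦ (hbus σ hσ).imp fun _ h ↦ ⟨h.1, h.2.1⟩) hγ hline hb hb₂ t (hlap _)) w

theorem theorem5 {E : Type*} [NormedAddCommGroup E] [NormedSpace ℝ E] [FiniteDimensional ℝ E]
    {M : Type*} [MetricSpace M] [ChartedSpace E M] [IsManifold 𝓘(ℝ, E) ∞ M]
    [RiemannianBundle (fun x : M ↦ TangentSpace 𝓘(ℝ, E) x)]
    [IsContMDiffRiemannianBundle 𝓘(ℝ, E) ∞ E (fun x : M ↦ TangentSpace 𝓘(ℝ, E) x)]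
    [IsRiemannianManifold 𝓘(ℝ, E) M]
    (hM : RiemGeom.IsAsymptoticallyHarmonic E M 0)
    (hsym : RiemGeom.IsSymmetricSpace E M) :
    RiemGeom.IsFlat E M :=
  theorem5_general (fun γ hγ ↦ (hM.laplacian_busemann γ hγ).imp
    fun _ ⟨hb, hb₂, hlap⟩ ↦ ⟨hb, hb₂, fun x ↦ (hlap x).le⟩) hsym
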